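/- \textbf{Setting.} Let $m\ge 0$, $n,s\ge 1$, let $A\subset\mathbb R^m$ satisfy $\mathbf 0\in A$ and $\|x-y\|_2\le D$ for all $x,y\in A$, let $Y_1,\dots,Y_n\in A$, let $P$ be a Borel probability measure on $\mathbb R^m$ supported in $A$ (i.e. $P$-almost every point lies in $A$), and let $\lambda>0$. Put $P_n=\frac1n\sum_{j=1}^n\delta_{Y_j}$ and $$\ell_\lambda(P_n,P)=\inf_{Q\ll P_n}\Big[\tfrac1\lambda\,\mathrm{KL}(Q,P_n)+W_2^2(P,Q)\Big],$$ where $Q$ ranges over probability measures and $W_2$ is the Wasserstein-2 distance for the Euclidean norm. Let $$h_1(x,g)=\min_{1\le j\le n}\big(\|x-Y_j\|_2^2-g_j\big)-\frac1\lambda\log\Big(\sum_{t=1}^n\tfrac1n e^{-\lambda g_t}\Big),\qquad x\in\mathbb R^m,\ g\in\mathbb R^n .$$ \textbf{Algorithm.} Input: $g_0\in\mathbb R^n$, $s$, $\lambda>0$, $B>0$, the points $Y_1,\dots,Y_n$, and samples $X_1,\dots,X_s$. For $i=1,\dots,s$ let $\gamma_i=B\sqrt{n/i}$, let $j_i^*$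 be a minimizer of $\|X_i-Y_j\|_2^2-g_{i-1,j}$ over $j$, and set $$g_{i,j}=g_{i-1,j}+\gamma_i\Big(\frac{e^{-\lambda g_{i-1,j}}}{\sum_{l=1}^n e^{-\lambda g_{i-1,l}}}-\mathbb 1(j=j_i^*)\Big),\qquad 1\le j\le n.$$ Output: $\hat x_{s,g_0,B}=\big(\sum_{i=1}^s\gamma_i\big)^{-1}\sum_{i=1}^s\gamma_i\,h_1(X_i,g_{i-1})$ and the final iterate $g_s$. Here $j_i^*=J(X_i,g_{i-1})$ for a measurable rule $J$ that selects a minimizer; ties may be broken in any way. \textbf{Theorem.} (a) Let $X_1,\dots,X_s$ be i.i.d. with law $P$, let $g_0=\mathbf 0$ and $B>0$. Then, for every tie-breaking rule, $\ell_\lambda(P_n,P)$ is finite, $\hat x_{s,g_0,B}$ is integrable, and $$\mathbb E\,\big|\hat x_{s,g_0,B}-\ell_\lambda(P_n,P)\big|\le 3D^2\sqrt{\frac{1+\log s}{s}}+\sqrt{\frac ns}\cdot\begin{cases}\dfrac{D^2}{2}+2D^2(1+\log s), & B=D^2,\\[2mm] \dfrac{D^4}{2}+2(1+\log s), & B=1.\end{cases}$$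 (b) $\hat x_{s,g_0,B}$ is computed in $O(ns)$ time for fixed dimension $m$. Precisely, the algorithm, written out as one explicit program (the same for all inputs) of a real random access machine on which each real or index arithmetic operation, comparison, evaluation of $\sqrt{\cdot}$, $\exp$, $\log$, memory access and assignment is one step, has the following property. There is an absolute constant $C$ such that for all $m\ge0$, $n\ge1$ and $Y_1,\dots,Y_n\in\mathbb R^m$ there is a tie-breaking rule for which, for all $s\ge1$, $\lambda,B>0$, $g_0\in\mathbb R^n$ and $X_1,\dots,X_s\in\mathbb R^m$, the program outputs exactly $\hat x_{s,g_0,B}$ and $g_s$ after at most $C\,(m+1)\,n\,s$ steps. -/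

import Mathlib

open MeasureTheory ProbabilityTheory
open scoped ENNReal

/-! ## The robust semi-constrained Wasserstein-2 divergence -/

namespace RSW

/-- `ℝᵐ` with the Euclidean norm. -/
abbrev E (m : ℕ) : Type := EuclideanSpace ℝ (Fin m)

/-- The couplings of `P` and `Q`: measures on the product with first marginal `P` and second
marginal `Q`. -/
def couplings {m : ℕ} (P Q : Measure (E m)) : Set (Measure (E m × E m)) :=
  {π | π.map Prod.fst = P ∧ π.map Prod.snd = Q}

/-- The Wasserstein-`p` distance, with values in `[0, ∞]`. -/
noncomputable def wasserstein {m : ℕ} (p : ℝ) (P Q : Measure (E m)) : ℝ≥0∞ :=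
  (⨅ π ∈ couplings P Q, ∫⁻ z, ‖z.1 - z.2‖ₑ ^ p ∂π) ^ (1 / p)

/-- `ℓ_λ(P₁, P₂) = inf_{Q ≪ P₁} [ (1/λ) KL(Q, P₁) + W₂²(P₂, Q) ]`, the infimum being over
probability measures `Q`, with values in `[0, ∞]`. -/
noncomputable def rsw {m : ℕ} (lam : ℝ) (P₁ P₂ : Measure (E m)) : ℝ≥0∞ :=
  ⨅ Q ∈ {Q : Measure (E m) | IsProbabilityMeasure Q ∧ Q ≪ P₁},
    ENNReal.ofReal (1 / lam) * InformationTheory.klDiv Q P₁ + wasserstein 2 P₂ Q ^ 2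

/-- The empirical measure `∑ j, (1/n) δ_{Y j}`. -/
noncomputable def empirical {m n : ℕ} (Y : Fin n → E m) : Measure (E m) :=
  ∑ j, (n : ℝ≥0∞)⁻¹ • Measure.dirac (Y j)

/-! ## Stochastic subgradient ascent -/

/-- `h₁(x, g) = min_j (‖x - Y j‖² - g j) - (1/λ) log (∑ t, (1/n) exp (-λ g t))`. -/
noncomputable def h₁ {m n : ℕ} (lam : ℝ) (Y : Fin n → E m) (x : E m) (g : Fin n → ℝ) : ℝ :=
  (⨅ j, (‖x - Y j‖ ^ 2 - g j))
    - 1 / lam * Real.log (∑ t, 1 / (n : ℝ) * Real.exp (-lam * g t))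

/-- A (measurable) rule that picks, for every `x` and `g`, an index minimizing
`‖x - Y j‖² - g j`; ties may be broken in any way. -/
structure IsArgminRule {m n : ℕ} (Y : Fin n → E m) (J : E m → (Fin n → ℝ) → Fin n) : Prop where
  measurable : Measurable (Function.uncurry J)
  isMin : ∀ x g j, ‖x - Y (J x g)‖ ^ 2 - g (J x g) ≤ ‖x - Y j‖ ^ 2 - g j

/-- The learning rate `γ_i = B √(n / i)`. -/
noncomputable def learningRate (n : ℕ) (B : ℝ) (i : ℕ) : ℝ := B * √((n : ℝ) / (i : ℝ))

/-- The iterates `g_0, g_1, …`. The samples are numbered from `0`: `X i` is the sample drawn in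
iteration `i + 1`. -/
noncomputable def iterate {m n : ℕ} (lam B : ℝ) (Y : Fin n → E m)
    (J : E m → (Fin n → ℝ) → Fin n) (g₀ : Fin n → ℝ) (X : ℕ → E m) : ℕ → Fin n → ℝ
  | 0 => g₀
  | i + 1 => fun j =>
      iterate lam B Y J g₀ X i j + learningRate n B (i + 1) *
        (Real.exp (-lam * iterate lam B Y J g₀ X i j)
            / (∑ l, Real.exp (-lam * iterate lam B Y J g₀ X i l))
          - if j = J (X i) (iterate lam B Y J g₀ X i) then 1 else 0)

/-- The value returned after `s` iterations: the average of the `h₁(X_i, g_{i-1})`,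
`1 ≤ i ≤ s`, with weights `γ_i`. -/
noncomputable def estimate {m n : ℕ} (lam B : ℝ) (Y : Fin n → E m)
    (J : E m → (Fin n → ℝ) → Fin n) (g₀ : Fin n → ℝ) (s : ℕ) (X : ℕ → E m) : ℝ :=
  (∑ i ∈ Finset.range s,
      learningRate n B (i + 1) * h₁ lam Y (X i) (iterate lam B Y J g₀ X i))
    / ∑ i ∈ Finset.range s, learningRate n B (i + 1)

end RSW

/-! ## A real random access machine with a step count

Programs are structured programs over finitely many index registers (natural numbers), real
registers and real arrays. Every arithmetic operation, comparison, evaluation of `√`, `exp`, `log`,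
register or memory access and every assignment costs one step. -/

namespace RealRAM

/-- Index expressions, over the index registers `ι`. -/
inductive IExpr (ι : Type) : Type
  | var (i : ι)
  | lit (k : ℕ)
  | add (e f : IExpr ι)
  | mul (e f : IExpr ι)

/-- Real expressions, over index registers `ι`, real registers `ρ` and arrays `α`; `get a e` is
the content of the cell of array `a` with index `e`. -/
inductive RExpr (ι ρ α : Type) : Type
  | var (r : ρ)
  | lit (k : ℕ)
  | ofIdx (e : IExpr ι)
  | get (a : α) (e : IExpr ι)
  | neg (u : RExpr ι ρ α)
  | add (u v : RExpr ι ρ α)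
  | sub (u v : RExpr ι ρ α)
  | mul (u v : RExpr ι ρ α)
  | div (u v : RExpr ι ρ α)
  | sqrt (u : RExpr ι ρ α)
  | exp (u : RExpr ι ρ α)
  | log (u : RExpr ι ρ α)

instance {ι : Type} : Add (IExpr ι) := ⟨IExpr.add⟩
instance {ι : Type} : Mul (IExpr ι) := ⟨IExpr.mul⟩
instance {ι ρ α : Type} : Neg (RExpr ι ρ α) := ⟨RExpr.neg⟩
instance {ι ρ α : Type} : Add (RExpr ι ρ α) := ⟨RExpr.add⟩
instance {ι ρ α : Type} : Sub (RExpr ι ρ α) := ⟨RExpr.sub⟩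
instance {ι ρ α : Type} : Mul (RExpr ι ρ α) := ⟨RExpr.mul⟩
instance {ι ρ α : Type} : Div (RExpr ι ρ α) := ⟨RExpr.div⟩

/-- Tests: a comparison of two reals, or an equality test of two indices. -/
inductive Test (ι ρ α : Type) : Type
  | lt (u v : RExpr ι ρ α)
  | idxEq (e f : IExpr ι)

/-- Programs. `loop i e c` is `for i = 0, …, e - 1 do c`, where `e` is evaluated once. -/
inductive Cmd (ι ρ α : Type) : Type
  | skip
  | setIdx (i : ι) (e : IExpr ι)
  | setReal (r : ρ) (u : RExpr ι ρ α)
  | store (a : α) (e : IExpr ι) (u : RExpr ι ρ α)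
  | seq (c d : Cmd ι ρ α)
  | ite (t : Test ι ρ α) (c d : Cmd ι ρ α)
  | loop (i : ι) (e : IExpr ι) (c : Cmd ι ρ α)

/-- The contents of the index registers, the real registers and the arrays. -/
structure State (ι ρ α : Type) : Type where
  idx : ι → ℕ
  reg : ρ → ℝ
  arr : α → ℕ → ℝ

variable {ι ρ α : Type}

/-- Sequential composition of a list of programs. -/
def Cmd.block : List (Cmd ι ρ α) → Cmd ι ρ α
  | [] => .skip
  | c :: cs => .seq c (Cmd.block cs)

def IExpr.eval (σ : State ι ρ α) : IExpr ι → ℕ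
  | .var i => σ.idx i
  | .lit k => k
  | .add e f => e.eval σ + f.eval σ
  | .mul e f => e.eval σ * f.eval σ

/-- The number of steps needed to evaluate an index expression. -/
def IExpr.cost : IExpr ι → ℕ
  | .var _ => 1
  | .lit _ => 1
  | .add e f => e.cost + f.cost + 1
  | .mul e f => e.cost + f.cost + 1

noncomputable def RExpr.eval (σ : State ι ρ α) : RExpr ι ρ α → ℝ
  | .var r => σ.reg r
  | .lit k => (k : ℝ)
  | .ofIdx e => (e.eval σ : ℝ)
  | .get a e => σ.arr a (e.eval σ)
  | .neg u => -u.eval σ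
  | .add u v => u.eval σ + v.eval σ
  | .sub u v => u.eval σ - v.eval σ
  | .mul u v => u.eval σ * v.eval σ
  | .div u v => u.eval σ / v.eval σ
  | .sqrt u => √(u.eval σ)
  | .exp u => Real.exp (u.eval σ)
  | .log u => Real.log (u.eval σ)

/-- The number of steps needed to evaluate a real expression. -/
def RExpr.cost : RExpr ι ρ α → ℕ
  | .var _ => 1
  | .lit _ => 1
  | .ofIdx e => e.cost + 1
  | .get _ e => e.cost + 1
  | .neg u => u.cost + 1
  | .add u v => u.cost + v.cost + 1
  | .sub u v => u.cost + v.cost + 1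
  | .mul u v => u.cost + v.cost + 1
  | .div u v => u.cost + v.cost + 1
  | .sqrt u => u.cost + 1
  | .exp u => u.cost + 1
  | .log u => u.cost + 1

def Test.Holds (σ : State ι ρ α) : Test ι ρ α → Prop
  | .lt u v => u.eval σ < v.eval σ
  | .idxEq e f => e.eval σ = f.eval σ

def Test.cost : Test ι ρ α → ℕ
  | .lt u v => u.cost + v.cost + 1
  | .idxEq e f => e.cost + f.cost + 1

/-- The first `N` rounds of a loop with loop register `i` and body semantics `f`, started in state
`σ`: the state reached and the number of steps used, one step being charged per round for the
loop itself. -/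
def rounds [DecidableEq ι] (f : State ι ρ α → State ι ρ α × ℕ) (i : ι) (σ : State ι ρ α) :
    ℕ → State ι ρ α × ℕ
  | 0 => (σ, 0)
  | N + 1 =>
      let p := rounds f i σ N
      let q := f { p.1 with idx := Function.update p.1.idx i N }
      (q.1, p.2 + q.2 + 1)

open Classical in
/-- Execution of a program: the final state and the number of steps. -/
noncomputable def Cmd.run [DecidableEq ι] [DecidableEq ρ] [DecidableEq α] :
    Cmd ι ρ α → State ι ρ α → State ι ρ α × ℕ
  | .skip, σ => (σ, 0)
  | .setIdx i e, σ => ({ σ with idx := Function.update σ.idx i (e.eval σ) }, e.cost + 1)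
  | .setReal r u, σ => ({ σ with reg := Function.update σ.reg r (u.eval σ) }, u.cost + 1)
  | .store a e u, σ =>
      ({ σ with arr := Function.update σ.arr a (Function.update (σ.arr a) (e.eval σ) (u.eval σ)) },
        e.cost + u.cost + 1)
  | .seq c d, σ =>
      let p := c.run σ
      let q := d.run p.1
      (q.1, p.2 + q.2)
  | .ite t c d, σ =>
      let q := if t.Holds σ then c.run σ else d.run σ
      (q.1, t.cost + q.2)
  | .loop i e c, σ =>
      let p := rounds c.run i σ (e.eval σ)
      (p.1, e.cost + p.2 + 1)

end RealRAM

/-! ## The ascent as a program of the machine -/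

namespace RSW

open RealRAM

/-- Index registers: the sizes `m`, `n`, `s`, the loop registers, and the minimizing index. -/
inductive IVar : Type
  | m | n | s | i | j | k | jstar
  deriving DecidableEq

/-- Real registers; `lam` and `B` are inputs, `out` is the output. -/
inductive RVar : Type
  | lam | B | gamma | gammaSum | runningAvg | dist | expSum | out
  deriving DecidableEq

/-- Arrays: the samples and the data (stored row by row), the vector `g`, and the values
`‖X_i - Y_j‖² - g_j`. -/
inductive Arr : Type
  | X | Y | g | val
  deriving DecidableEq

/-- Stochastic subgradient ascent as a program. -/
def program : Cmd IVar RVar Arr :=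
  let idx (v : IVar) : IExpr IVar := .var v
  let reg (r : RVar) : RExpr IVar RVar Arr := .var r
  let get (a : Arr) (e : IExpr IVar) : RExpr IVar RVar Arr := .get a e
  let diff := get .X (idx .i * idx .m + idx .k) - get .Y (idx .j * idx .m + idx .k)
  let weight := RExpr.exp (-(reg .lam * get .g (idx .j)))
  .block [
    .setReal .runningAvg (.lit 0),
    .setReal .gammaSum (.lit 0),
    .loop .i (idx .s) (.block [
      -- the learning rate
      .setReal .gamma (reg .B * .sqrt (.ofIdx (idx .n) / .ofIdx (idx .i + .lit 1))),
      -- the values to be minimized and the sum of the exponentials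
      .setReal .expSum (.lit 0),
      .loop .j (idx .n) (.block [
        .setReal .dist (.lit 0),
        .loop .k (idx .m) (.setReal .dist (reg .dist + diff * diff)),
        .store .val (idx .j) (reg .dist - get .g (idx .j)),
        .setReal .expSum (reg .expSum + weight)]),
      -- a minimizing index
      .setIdx .jstar (.lit 0),
      .loop .j (idx .n)
        (.ite (.lt (get .val (idx .j)) (get .val (idx .jstar)))
          (.setIdx .jstar (idx .j)) .skip),
      -- the running average
      .setReal .runningAvg (reg .runningAvg + reg .gamma *
        (get .val (idx .jstar) - .lit 1 / reg .lam * .log (reg .expSum / .ofIdx (idx .n)))),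
      .setReal .gammaSum (reg .gammaSum + reg .gamma),
      -- the subgradient step
      .loop .j (idx .n)
        (.ite (.idxEq (idx .j) (idx .jstar))
          (.store .g (idx .j)
            (get .g (idx .j) + reg .gamma * (weight / reg .expSum - .lit 1)))
          (.store .g (idx .j)
            (get .g (idx .j) + reg .gamma * (weight / reg .expSum - .lit 0))))]),
    .setReal .out (reg .runningAvg / reg .gammaSum)]

/-- The machine holds the input: sizes, `λ`, `B`, data `Y`, the first `s` samples, and `g₀`. The
other registers and cells may hold anything. -/
structure HoldsInput {m n : ℕ} (lam B : ℝ) (Y : Fin n → E m) (g₀ : Fin n → ℝ) (s : ℕ)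
    (X : ℕ → E m) (σ : State IVar RVar Arr) : Prop where
  m_eq : σ.idx .m = m
  n_eq : σ.idx .n = n
  s_eq : σ.idx .s = s
  lam_eq : σ.reg .lam = lam
  B_eq : σ.reg .B = B
  Y_eq : ∀ (j : Fin n) (k : Fin m), σ.arr .Y (j * m + k) = Y j k
  X_eq : ∀ i < s, ∀ k : Fin m, σ.arr .X (i * m + k) = X i k
  g_eq : ∀ j : Fin n, σ.arr .g j = g₀ j

end RSW

/-! The algorithm is stochastic supergradient ascent on a semi-dual problem. For fixed `x` the
function `h₁ lam Y x` is concave in `g`, and the supremum over `g` of its `P`-mean is ℓ, the real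
value of `rsw lam (empirical Y) P`.

Weak duality (`ofReal_integral_h₁_le_rsw`) adds two inequalities: Kantorovich's, integrated against
any coupling, and the Gibbs variational inequality for relative entropy. The converse, up to an
error `n * ε`, is `exists_rsw_le`. There the minimum in `h₁` is replaced by a soft minimum at
temperature `ε`. The smoothed dual has a maximizer, by translation invariance and coercivity.
Stationarity says that the mean soft assignment equals the Gibbs weights of the potential, so soft
assignment is a coupling of `P` with the Gibbs measure, an explicit competitor in the primal
problem. By truncation (`exists_bounded_potential`) a nearly optimal potential `u` may be taken with
entries in `[0, K]`, where `K = D ^ 2` bounds the squared distances.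

For the accuracy, let `W` be the sum of the learning rates γ, `V` the sum of their squares, `T` the
weighted sum of the sampled values of `h₁`, and `S` the weighted sum of the deviations of these
values from their `P`-means at the current iterate. Then `T - S` is a weighted sum of true means, so
weak duality gives `T - S ≤ W * ℓ` and hence `|T - W * ℓ| ≤ |S| + (W * ℓ - T + S)`. The pathwise
regret bound `regret_le` against `u` bounds `T` from below at a cost of `n * K ^ 2 / 2 + V`. In
expectation `S` vanishes, near-optimality of `u` costs arbitrarily little, and orthogonality of
martingale increments gives `E|S| ≤ K * √V`. It remains to divide by `W ≥ B * √(n * s)` and to use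
`V ≤ B ^ 2 * n * (1 + log s)`.

For the running time, loop invariants that carry a step budget (`Spec`) verify the program against
the recursion, with ties broken in favour of the first minimizer. -/

namespace RealRAM

/-! ### Program logic with step budgets -/

variable {ι ρ α : Type}

/-- The loop register is overwritten before every round, so the invariant is assumed of the state
before that write, and the body cannot alter the number of rounds. The `+ 1` is the charge per
round. -/
theorem rounds_invariant [DecidableEq ι] {f : State ι ρ α → State ι ρ α × ℕ} {i : ι}
    {σ : State ι ρ α} {Inv : ℕ → State ι ρ α → Prop} {c N : ℕ} (h0 : Inv 0 σ)
    (hstep : ∀ k < N, ∀ τ, Inv k τ →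
      Inv (k + 1) (f { τ with idx := Function.update τ.idx i k }).1 ∧
        (f { τ with idx := Function.update τ.idx i k }).2 ≤ c) :
    Inv N (rounds f i σ N).1 ∧ (rounds f i σ N).2 ≤ N * (c + 1) := by
  induction N with
  | zero => exact ⟨h0, by simp [rounds]⟩
  | succ N ih =>
    obtain ⟨h1, h2⟩ := ih fun k hk => hstep k (by omega)
    obtain ⟨h3, h4⟩ := hstep N (by omega) _ h1
    refine ⟨h3, ?_⟩
    simp only [rounds]
    rw [Nat.add_mul]
    omega

variable [DecidableEq ι] [DecidableEq ρ] [DecidableEq α]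

/-- Started in `σ`, the program `c` ends in a state satisfying `post` after at most `b` steps. -/
def Spec (c : Cmd ι ρ α) (σ : State ι ρ α) (post : State ι ρ α → Prop) (b : ℕ) : Prop :=
  post (c.run σ).1 ∧ (c.run σ).2 ≤ b

theorem Spec.seq {c d : Cmd ι ρ α} {σ : State ι ρ α} {Q R : State ι ρ α → Prop} {b₁ b₂ : ℕ}
    (hc : Spec c σ Q b₁) (hd : ∀ τ, Q τ → Spec d τ R b₂) : Spec (.seq c d) σ R (b₁ + b₂) := by
  obtain ⟨h1, h2⟩ := hd _ hc.1
  exact ⟨h1, Nat.add_le_add hc.2 h2⟩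

theorem Spec.mono {c : Cmd ι ρ α} {σ : State ι ρ α} {Q R : State ι ρ α → Prop} {b b' : ℕ}
    (h : Spec c σ Q b) (hQR : ∀ τ, Q τ → R τ) (hb : b ≤ b') : Spec c σ R b' :=
  ⟨hQR _ h.1, h.2.trans hb⟩

theorem Spec.skip {σ : State ι ρ α} {Q : State ι ρ α → Prop} (h : Q σ) :
    Spec .skip σ Q 0 := ⟨h, le_rfl⟩

theorem Spec.setIdx {i : ι} {e : IExpr ι} {σ : State ι ρ α} {Q : State ι ρ α → Prop}
    (h : Q { σ with idx := Function.update σ.idx i (e.eval σ) }) :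
    Spec (.setIdx i e) σ Q (e.cost + 1) := ⟨h, le_rfl⟩

theorem Spec.setReal {r : ρ} {u : RExpr ι ρ α} {σ : State ι ρ α} {Q : State ι ρ α → Prop}
    (h : Q { σ with reg := Function.update σ.reg r (u.eval σ) }) :
    Spec (.setReal r u) σ Q (u.cost + 1) := ⟨h, le_rfl⟩

theorem Spec.store {a : α} {e : IExpr ι} {u : RExpr ι ρ α} {σ : State ι ρ α}
    {Q : State ι ρ α → Prop}
    (h : Q { σ with
      arr := Function.update σ.arr a (Function.update (σ.arr a) (e.eval σ) (u.eval σ)) }) :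
    Spec (.store a e u) σ Q (e.cost + u.cost + 1) := ⟨h, le_rfl⟩

theorem Spec.ite {t : Test ι ρ α} {c d : Cmd ι ρ α} {σ : State ι ρ α} {Q : State ι ρ α → Prop}
    {b : ℕ} (hc : t.Holds σ → Spec c σ Q b) (hd : ¬ t.Holds σ → Spec d σ Q b) :
    Spec (.ite t c d) σ Q (t.cost + b) := by
  unfold Spec at *
  by_cases h : t.Holds σ
  · simpa [Cmd.run, h] using hc h
  · simpa [Cmd.run, h] using hd h

theorem Spec.loop {i : ι} {e : IExpr ι} {c : Cmd ι ρ α} {σ : State ι ρ α}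
    (Inv : ℕ → State ι ρ α → Prop) {b : ℕ} (h0 : Inv 0 σ)
    (hstep : ∀ k < e.eval σ, ∀ τ, Inv k τ →
      Spec c { τ with idx := Function.update τ.idx i k } (Inv (k + 1)) b) :
    Spec (.loop i e c) σ (Inv (e.eval σ)) (e.cost + e.eval σ * (b + 1) + 1) := by
  obtain ⟨h1, h2⟩ := rounds_invariant (f := c.run) h0 hstep
  exact ⟨h1, by simp only [Cmd.run]; omega⟩

end RealRAM

/-! ### The first minimizer, found by a linear scan -/

namespace RSW

open RealRAM

/-- The first index below `N` at which `v` is minimal, as found by a linear scan. -/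
noncomputable def scanMin (v : ℕ → ℝ) : ℕ → ℕ
  | 0 => 0
  | N + 1 => open Classical in if v N < v (scanMin v N) then N else scanMin v N

theorem scanMin_lt (v : ℕ → ℝ) {N : ℕ} (hN : 1 ≤ N) : scanMin v N < N := by
  induction N with
  | zero => omega
  | succ N ih =>
    rw [scanMin]
    split_ifs
    · omega
    · rcases Nat.eq_zero_or_pos N with rfl | h
      · simp [scanMin]
      · have := ih h
        omega

theorem scanMin_le (v : ℕ → ℝ) {N l : ℕ} (hl : l < N) : v (scanMin v N) ≤ v l := by
  induction N with
  | zero => omega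
  | succ N ih =>
    rw [scanMin]
    rcases Nat.lt_succ_iff_lt_or_eq.mp hl with h | rfl
    · split_ifs with h1
      · exact h1.le.trans (ih h)
      · exact ih h
    · split_ifs with h1
      · exact le_rfl
      · exact not_lt.mp h1

theorem scanMin_congr {v w : ℕ → ℝ} {N : ℕ} (h : ∀ l < N, v l = w l) :
    scanMin v N = scanMin w N := by
  induction N with
  | zero => rfl
  | succ N ih =>
    have e := ih fun l hl => h l (by omega)
    -- `scanMin w N` is an index below `N` only when `N ≥ 1`. For `N = 0` both branches of the scan
    -- return `0`.
    rcases Nat.eq_zero_or_pos N with rfl | hN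
    · simp [scanMin]
    · rw [scanMin, scanMin, e, h N (by omega), h (scanMin w N) ((scanMin_lt w hN).trans (by omega))]

/-- The scan compares with the entry at an index that itself depends on `b`. As indices are
countable, evaluation is jointly measurable. -/
theorem measurable_scanMin {β : Type*} [MeasurableSpace β] {v : β → ℕ → ℝ}
    (hv : ∀ l, Measurable fun b => v b l) (N : ℕ) : Measurable fun b => scanMin (v b) N := by
  induction N with
  | zero => exact measurable_const
  | succ N ih =>
    have h : Measurable fun b => v b (scanMin (v b) N) := by
      have h1 : Measurable fun q : β × ℕ => v q.1 q.2 :=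
        measurable_from_prod_countable_left fun l => hv l
      exact h1.comp (measurable_id.prodMk ih)
    simp only [scanMin]
    exact Measurable.ite (measurableSet_lt (hv N) h) measurable_const ih

/-- The values `‖x - Y j‖² - g j`, extended by `0` to all natural numbers. -/
noncomputable def shiftedCost {m n : ℕ} (Y : Fin n → E m) (x : E m) (g : Fin n → ℝ) (l : ℕ) : ℝ :=
  if h : l < n then ‖x - Y ⟨l, h⟩‖ ^ 2 - g ⟨l, h⟩ else 0

/-- The rule that picks the first minimizing index. -/
noncomputable def firstArgmin {m n : ℕ} (hn : 1 ≤ n) (Y : Fin n → E m) (x : E m)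
    (g : Fin n → ℝ) : Fin n :=
  ⟨scanMin (shiftedCost Y x g) n, scanMin_lt _ hn⟩

theorem isArgminRule_firstArgmin {m n : ℕ} (hn : 1 ≤ n) (Y : Fin n → E m) :
    IsArgminRule Y (firstArgmin hn Y) where
  measurable := by
    have h : Measurable fun p : E m × (Fin n → ℝ) => scanMin (shiftedCost Y p.1 p.2) n := by
      refine measurable_scanMin (fun l => ?_) n
      unfold shiftedCost
      split_ifs
      · fun_prop
      · exact measurable_const
    refine measurable_to_countable' fun j => ?_
    convert h (measurableSet_singleton (j : ℕ)) using 1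
    ext p
    simp [firstArgmin, Function.uncurry, Fin.ext_iff]
  isMin x g j := by
    have := scanMin_le (shiftedCost Y x g) j.2
    simpa [shiftedCost, firstArgmin, scanMin_lt _ hn] using this

end RSW

/-! ### Correctness and cost of the program -/

namespace RealRAM

@[simp]
theorem RExpr.eval_hAdd {ι ρ α : Type} (σ : State ι ρ α) (u v : RExpr ι ρ α) :
    RExpr.eval σ (u + v) = u.eval σ + v.eval σ := rfl

@[simp]
theorem RExpr.eval_hSub {ι ρ α : Type} (σ : State ι ρ α) (u v : RExpr ι ρ α) :
    RExpr.eval σ (u - v) = u.eval σ - v.eval σ := rfl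

@[simp]
theorem RExpr.eval_hMul {ι ρ α : Type} (σ : State ι ρ α) (u v : RExpr ι ρ α) :
    RExpr.eval σ (u * v) = u.eval σ * v.eval σ := rfl

@[simp]
theorem RExpr.eval_hDiv {ι ρ α : Type} (σ : State ι ρ α) (u v : RExpr ι ρ α) :
    RExpr.eval σ (u / v) = u.eval σ / v.eval σ := rfl

end RealRAM

namespace RSW

open RealRAM

/-- The exponential weight of `g j`. -/
def weightExpr : RExpr IVar RVar Arr :=
  .exp (-(RExpr.var .lam * RExpr.get .g (.var .j)))

/-- The inner loop that accumulates `‖X i - Y j‖²`. -/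
def distLoop : Cmd IVar RVar Arr :=
  let diff : RExpr IVar RVar Arr :=
    RExpr.get .X (IExpr.var .i * IExpr.var .m + IExpr.var .k)
      - RExpr.get .Y (IExpr.var .j * IExpr.var .m + IExpr.var .k)
  .loop .k (.var .m) (.setReal .dist (RExpr.var .dist + diff * diff))

/-- The loop that computes the values to be minimized and the sum of the exponentials. -/
def valueLoop : Cmd IVar RVar Arr :=
  .loop .j (.var .n) (.block [
    .setReal .dist (.lit 0),
    distLoop,
    .store .val (.var .j) (RExpr.var .dist - RExpr.get .g (.var .j)),
    .setReal .expSum (RExpr.var .expSum + weightExpr)])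

/-- The loop that searches for a minimizing index. -/
def argminLoop : Cmd IVar RVar Arr :=
  .loop .j (.var .n)
    (.ite (.lt (.get .val (.var .j)) (.get .val (.var .jstar)))
      (.setIdx .jstar (.var .j)) .skip)

/-- The loop that performs the subgradient step. -/
def updateLoop : Cmd IVar RVar Arr :=
  .loop .j (.var .n)
    (.ite (.idxEq (.var .j) (.var .jstar))
      (.store .g (.var .j)
        (RExpr.get .g (.var .j) + RExpr.var .gamma * (weightExpr / RExpr.var .expSum - .lit 1)))
      (.store .g (.var .j)
        (RExpr.get .g (.var .j) + RExpr.var .gamma * (weightExpr / RExpr.var .expSum - .lit 0))))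

/-- One iteration of the ascent. -/
def stepCmd : Cmd IVar RVar Arr :=
  .block [
    .setReal .gamma (RExpr.var .B *
      .sqrt (RExpr.ofIdx (.var .n) / RExpr.ofIdx (IExpr.var .i + IExpr.lit 1))),
    .setReal .expSum (.lit 0),
    valueLoop,
    .setIdx .jstar (.lit 0),
    argminLoop,
    .setReal .runningAvg (RExpr.var .runningAvg + RExpr.var .gamma *
      (RExpr.get .val (.var .jstar) - RExpr.lit 1 / RExpr.var .lam *
        .log (RExpr.var .expSum / RExpr.ofIdx (.var .n)))),
    .setReal .gammaSum (RExpr.var .gammaSum + RExpr.var .gamma),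
    updateLoop]

/-- Naming the inner loops allows each to be verified separately. -/
theorem program_eq : program =
    .block [
      .setReal .runningAvg (.lit 0),
      .setReal .gammaSum (.lit 0),
      .loop .i (.var .s) stepCmd,
      .setReal .out (RExpr.var .runningAvg / RExpr.var .gammaSum)] := rfl

/-- Each loop specification also records what the loop leaves unchanged, which the next command
relies on. The step budgets are round numbers, not sharp ones. -/
theorem distLoop_spec (σ : State IVar RVar Arr) :
    Spec distLoop σ (fun τ => τ.arr = σ.arr ∧ (∀ v, v ≠ .k → τ.idx v = σ.idx v) ∧
      (∀ r, r ≠ .dist → τ.reg r = σ.reg r) ∧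
      τ.reg .dist = σ.reg .dist + ∑ l ∈ Finset.range (σ.idx .m),
        (σ.arr .X (σ.idx .i * σ.idx .m + l) - σ.arr .Y (σ.idx .j * σ.idx .m + l)) ^ 2)
      (2 + σ.idx .m * 40) := by
  refine Spec.mono (Spec.loop (fun k τ => τ.arr = σ.arr ∧ (∀ v, v ≠ .k → τ.idx v = σ.idx v) ∧
      (∀ r, r ≠ .dist → τ.reg r = σ.reg r) ∧
      τ.reg .dist = σ.reg .dist + ∑ l ∈ Finset.range k,
        (σ.arr .X (σ.idx .i * σ.idx .m + l) - σ.arr .Y (σ.idx .j * σ.idx .m + l)) ^ 2)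
      (b := 39) ?_ ?_) (fun τ h => h) ?_
  · simp
  · rintro k - τ ⟨h1, h2, h3, h4⟩
    refine Spec.mono (Spec.setReal (Q := fun τ => _) ?_) (fun τ h => h) (by decide)
    refine ⟨h1, fun v hv => ?_, fun r hr => ?_, ?_⟩
    · simp [hv, h2 v hv]
    · simp [hr, h3 r hr]
    · simp [RExpr.eval, IExpr.eval, Finset.sum_range_succ, h1, h2, h4]
      ring
  · simp [IExpr.cost, IExpr.eval]

theorem valueLoop_spec (σ : State IVar RVar Arr) :
    Spec valueLoop σ (fun τ => (∀ a, a ≠ .val → τ.arr a = σ.arr a) ∧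
      (∀ v, v ≠ .k → v ≠ .j → τ.idx v = σ.idx v) ∧
      (∀ r, r ≠ .dist → r ≠ .expSum → τ.reg r = σ.reg r) ∧
      (∀ j < σ.idx .n, τ.arr .val j = ∑ l ∈ Finset.range (σ.idx .m),
        (σ.arr .X (σ.idx .i * σ.idx .m + l) - σ.arr .Y (j * σ.idx .m + l)) ^ 2 - σ.arr .g j) ∧
      τ.reg .expSum = σ.reg .expSum +
        ∑ l ∈ Finset.range (σ.idx .n), Real.exp (-(σ.reg .lam * σ.arr .g l)))
      (2 + σ.idx .n * (40 + σ.idx .m * 40)) := by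
  refine Spec.mono (Spec.loop (fun j' τ => (∀ a, a ≠ .val → τ.arr a = σ.arr a) ∧
      (∀ v, v ≠ .k → v ≠ .j → τ.idx v = σ.idx v) ∧
      (∀ r, r ≠ .dist → r ≠ .expSum → τ.reg r = σ.reg r) ∧
      (∀ j < j', τ.arr .val j = ∑ l ∈ Finset.range (σ.idx .m),
        (σ.arr .X (σ.idx .i * σ.idx .m + l) - σ.arr .Y (j * σ.idx .m + l)) ^ 2 - σ.arr .g j) ∧
      τ.reg .expSum = σ.reg .expSum +
        ∑ l ∈ Finset.range j', Real.exp (-(σ.reg .lam * σ.arr .g l)))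
      (b := 39 + σ.idx .m * 40) ?_ ?_) (fun τ h => h) ?_
  · simp
  · rintro j' - τ ⟨h1, h2, h3, h4, h5⟩
    have hm : τ.idx .m = σ.idx .m := h2 _ (by decide) (by decide)
    have hi : τ.idx .i = σ.idx .i := h2 _ (by decide) (by decide)
    have hl : τ.reg .lam = σ.reg .lam := h3 _ (by decide) (by decide)
    have hX : τ.arr .X = σ.arr .X := h1 _ (by decide)
    have hY : τ.arr .Y = σ.arr .Y := h1 _ (by decide)
    have hg : τ.arr .g = σ.arr .g := h1 _ (by decide)
    refine Spec.mono (Spec.seq (Spec.setReal (Q := fun τ' => τ' = _) rfl) fun τ₁ e₁ => Spec.seq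
      ((distLoop_spec τ₁).mono (b' := 2 + σ.idx .m * 40) (fun _ h => h) (by simp [e₁, hm]))
      fun τ₂ h => Spec.seq (Spec.store (Q := fun τ' => τ' = _) rfl)
      fun τ₃ e₃ => Spec.seq (Spec.setReal (Q := fun τ' => τ' = _) rfl) fun τ₄ e₄ => Spec.skip ?_)
      (fun τ h => h) ?_
    · subst e₁
      obtain ⟨g1, g2, g3, g4⟩ := h
      have gj : τ₂.idx .j = j' := by rw [g2 _ (by decide)]; simp
      have gl : τ₂.reg .lam = σ.reg .lam := by rw [g3 _ (by decide)]; simp [hl]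
      have gS : τ₂.reg .expSum = τ.reg .expSum := by rw [g3 _ (by decide)]; simp
      subst e₃ e₄
      refine ⟨fun a ha => ?_, fun v hv hv' => ?_, fun r hr hr' => ?_, fun j hj => ?_, ?_⟩
      · simp [ha, g1, h1]
      · simp [g2 v hv, hv', h2 v hv hv']
      · simp [hr', g3 r hr, hr, h3 r hr hr']
      · simp only [Function.update_self, RExpr.eval_hSub, RExpr.eval, IExpr.eval, gj, g4, g1]
        rcases Nat.lt_succ_iff_lt_or_eq.mp hj with h | rfl
        · rw [Function.update_of_ne h.ne, h4 j h]
        · simp [hm, hi, hX, hY, hg]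
      · simp [weightExpr, RExpr.eval,
          IExpr.eval, gj, gl, gS, g1, hg, h5, Finset.sum_range_succ]
        ring
    · simp only [show RExpr.cost (ι := IVar) (ρ := RVar) (α := Arr) (.lit 0) = 1 from rfl,
        show IExpr.cost (IExpr.var IVar.j) = 1 from rfl,
        show (RExpr.var RVar.dist - RExpr.get Arr.g (IExpr.var IVar.j)).cost = 4 from rfl,
        show (RExpr.var RVar.expSum + weightExpr).cost = 8 from rfl]
      omega
  · simp only [IExpr.cost, IExpr.eval]
    have : 39 + σ.idx .m * 40 + 1 = 40 + σ.idx .m * 40 := by omega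
    rw [this]
    omega

/-- A strict comparison keeps the earlier index at a tie, exactly as `scanMin` does, and both start
from index `0`. -/
theorem argminLoop_spec (σ : State IVar RVar Arr) (h0 : σ.idx .jstar = 0) :
    Spec argminLoop σ (fun τ => τ.arr = σ.arr ∧ τ.reg = σ.reg ∧
      (∀ v, v ≠ .jstar → v ≠ .j → τ.idx v = σ.idx v) ∧
      τ.idx .jstar = scanMin (σ.arr .val) (σ.idx .n))
      (2 + σ.idx .n * 10) := by
  refine Spec.mono (Spec.loop (fun N τ => τ.arr = σ.arr ∧ τ.reg = σ.reg ∧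
      (∀ v, v ≠ .jstar → v ≠ .j → τ.idx v = σ.idx v) ∧
      τ.idx .jstar = scanMin (σ.arr .val) N) (b := 9) ?_ ?_) (fun τ h => h) ?_
  · simp [h0, scanMin]
  · rintro N - τ ⟨h1, h2, h3, h4⟩
    refine Spec.mono (Spec.ite (b := 2) (fun ht => Spec.mono (Spec.setIdx ?_) (fun _ h => h)
      (by decide)) (fun ht => Spec.mono (Spec.skip ?_) (fun _ h => h) (by decide)))
      (fun _ h => h) (by decide)
    · simp [Test.Holds, RExpr.eval, IExpr.eval, h1, h4] at ht
      refine ⟨h1, h2, fun v hv hv' => ?_, ?_⟩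
      · simp [hv, hv', h3]
      · simp [IExpr.eval, scanMin, ht]
    · simp [Test.Holds, RExpr.eval, IExpr.eval, h1, h4] at ht
      refine ⟨h1, h2, fun v hv hv' => ?_, ?_⟩
      · simp [hv', h3 v hv hv']
      · simp [scanMin, h4, ht.not_gt]
  · simp only [IExpr.cost, IExpr.eval]
    omega

theorem updateLoop_spec (σ : State IVar RVar Arr) :
    Spec updateLoop σ (fun τ => (∀ a, a ≠ .g → τ.arr a = σ.arr a) ∧ τ.reg = σ.reg ∧
      (∀ v, v ≠ .j → τ.idx v = σ.idx v) ∧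
      ∀ l < σ.idx .n, τ.arr .g l = σ.arr .g l + σ.reg .gamma *
        (Real.exp (-(σ.reg .lam * σ.arr .g l)) / σ.reg .expSum
          - if l = σ.idx .jstar then 1 else 0))
      (2 + σ.idx .n * 24) := by
  refine Spec.mono (Spec.loop (fun N τ => (∀ a, a ≠ .g → τ.arr a = σ.arr a) ∧ τ.reg = σ.reg ∧
      (∀ v, v ≠ .j → τ.idx v = σ.idx v) ∧
      (∀ l < N, τ.arr .g l = σ.arr .g l + σ.reg .gamma *
        (Real.exp (-(σ.reg .lam * σ.arr .g l)) / σ.reg .expSum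
          - if l = σ.idx .jstar then 1 else 0)) ∧
      -- Unvisited cells keep their old contents, so round `l` reads the old `g l`. The
      -- normalization `expSum` is not touched by the loop.
      ∀ l, N ≤ l → τ.arr .g l = σ.arr .g l) (b := 23) ?_ ?_) ?_ ?_
  · simp
  · rintro N - τ ⟨h1, h2, h3, h4, h5⟩
    have hj : τ.idx .jstar = σ.idx .jstar := h3 _ (by decide)
    refine Spec.mono (Spec.ite (b := 18) (fun ht => Spec.mono (Spec.store ?_) (fun _ h => h)
      (by decide)) (fun ht => Spec.mono (Spec.store ?_) (fun _ h => h) (by decide)))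
      (fun _ h => h) (by decide)
    all_goals
      simp [Test.Holds, IExpr.eval, hj] at ht
      refine ⟨fun a ha => ?_, h2, fun v hv => ?_, fun l hl => ?_, fun l hl => ?_⟩
      · simp [ha, h1]
      · simp [hv, h3 v hv]
      · rcases Nat.lt_succ_iff_lt_or_eq.mp hl with h | rfl
        · simp [IExpr.eval, h.ne, h4 l h]
        · simp [weightExpr, RExpr.eval, IExpr.eval, h5, h2, ht]
      · have : l ≠ N := by omega
        simp [IExpr.eval, this, h5 l (by omega)]
  · rintro τ ⟨h1, h2, h3, h4, -⟩
    exact ⟨h1, h2, h3, h4⟩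
  · simp only [IExpr.cost, IExpr.eval]
    omega

/-- The loop invariant of the ascent: the state after `i` iterations. -/
structure AfterSteps {m n : ℕ} (lam B : ℝ) (Y : Fin n → E m) (J : E m → (Fin n → ℝ) → Fin n)
    (g₀ : Fin n → ℝ) (s : ℕ) (X : ℕ → E m) (i : ℕ) (σ : State IVar RVar Arr) : Prop where
  m_eq : σ.idx .m = m
  n_eq : σ.idx .n = n
  lam_eq : σ.reg .lam = lam
  B_eq : σ.reg .B = B
  Y_eq : ∀ (j : Fin n) (k : Fin m), σ.arr .Y (j * m + k) = Y j k
  X_eq : ∀ i < s, ∀ k : Fin m, σ.arr .X (i * m + k) = X i k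
  g_eq : ∀ j : Fin n, σ.arr .g j = iterate lam B Y J g₀ X i j
  avg_eq : σ.reg .runningAvg = ∑ l ∈ Finset.range i,
    learningRate n B (l + 1) * h₁ lam Y (X l) (iterate lam B Y J g₀ X l)
  sum_eq : σ.reg .gammaSum = ∑ l ∈ Finset.range i, learningRate n B (l + 1)

theorem iInf_shiftedCost {m n : ℕ} {Y : Fin n → E m} {J : E m → (Fin n → ℝ) → Fin n}
    (hJ : IsArgminRule Y J) (x : E m) (g : Fin n → ℝ) :
    ⨅ j, (‖x - Y j‖ ^ 2 - g j) = ‖x - Y (J x g)‖ ^ 2 - g (J x g) :=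
  have : Nonempty (Fin n) := ⟨J x g⟩
  le_antisymm (ciInf_le (Set.finite_range _).bddBelow _) (le_ciInf (hJ.isMin x g))

theorem stepCmd_spec {m n : ℕ} (hn : 1 ≤ n) {lam B : ℝ} {Y : Fin n → E m}
    {g₀ : Fin n → ℝ} {s : ℕ} {X : ℕ → E m} {i : ℕ} (hi : i < s) {σ : State IVar RVar Arr}
    (h : AfterSteps lam B Y (firstArgmin hn Y) g₀ s X i σ) (hσ : σ.idx .i = i) :
    Spec stepCmd σ (AfterSteps lam B Y (firstArgmin hn Y) g₀ s X (i + 1))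
      (100 + n * (100 + m * 40)) := by
  set g := iterate lam B Y (firstArgmin hn Y) g₀ X i with hg
  have hJ := isArgminRule_firstArgmin hn Y
  -- Assignments receive the exact resulting state as postcondition; only the loops are known
  -- through their specifications.
  refine Spec.mono (Spec.seq ((Spec.setReal (Q := fun τ' => τ' = _) rfl).mono (b' := 18) (fun _ h => h) (by decide)) fun τ₁ e₁ => Spec.seq
    ((Spec.setReal (Q := fun τ' => τ' = _) rfl).mono (b' := 18) (fun _ h => h) (by decide)) fun τ₂ e₂ => Spec.seq
    ((valueLoop_spec τ₂).mono (b' := 2 + n * (40 + m * 40)) (fun _ h => h)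
      (by simp [e₁, e₂, h.m_eq, h.n_eq])) fun τ₃ q₃ => Spec.seq
    ((Spec.setIdx (Q := fun τ' => τ' = _) rfl).mono (b' := 2) (fun _ h => h) (by decide)) fun τ₄ e₄ => Spec.seq
    ((argminLoop_spec τ₄ (by simp [e₄, IExpr.eval])).mono (b' := 2 + n * 10) (fun _ h => h)
      (by
        have : τ₃.idx .n = n := by
          rw [q₃.2.1 _ (by decide) (by decide)]; simp [e₁, e₂, h.n_eq]
        simp [e₄, this])) fun τ₅ q₅ => Spec.seq
    ((Spec.setReal (Q := fun τ' => τ' = _) rfl).mono (b' := 18) (fun _ h => h) (by decide)) fun τ₆ e₆ => Spec.seq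
    ((Spec.setReal (Q := fun τ' => τ' = _) rfl).mono (b' := 18) (fun _ h => h) (by decide)) fun τ₇ e₇ => Spec.seq
    ((updateLoop_spec τ₇).mono (b' := 2 + n * 24) (fun _ h => h)
      (by
        have h3 : τ₃.idx .n = n := by
          rw [q₃.2.1 _ (by decide) (by decide)]; simp [e₁, e₂, h.n_eq]
        have : τ₅.idx .n = n := by
          rw [q₅.2.2.1 _ (by decide) (by decide)]; simp [e₄, h3]
        simp [e₆, e₇, this])) fun τ₈ q₈ => Spec.skip ?_) (fun τ h => h) ?_
  · obtain ⟨a3, i3, r3, v3, s3⟩ := q₃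
    obtain ⟨a5, r5, i5, j5⟩ := q₅
    obtain ⟨a8, r8, i8, g8⟩ := q₈
    have n3 : τ₃.idx .n = n := by rw [i3 _ (by decide) (by decide)]; simp [e₁, e₂, h.n_eq]
    have m3 : τ₃.idx .m = m := by rw [i3 _ (by decide) (by decide)]; simp [e₁, e₂, h.m_eq]
    have lam3 : τ₃.reg .lam = lam := by
      rw [r3 _ (by decide) (by decide)]; simp [e₁, e₂, h.lam_eq]
    have B3 : τ₃.reg .B = B := by rw [r3 _ (by decide) (by decide)]; simp [e₁, e₂, h.B_eq]
    have X3 : τ₃.arr .X = σ.arr .X := by rw [a3 _ (by decide)]; simp [e₁, e₂]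
    have Y3 : τ₃.arr .Y = σ.arr .Y := by rw [a3 _ (by decide)]; simp [e₁, e₂]
    have g3 : τ₃.arr .g = σ.arr .g := by rw [a3 _ (by decide)]; simp [e₁, e₂]
    have ga3 : τ₃.reg .gamma = learningRate n B (i + 1) := by
      rw [r3 _ (by decide) (by decide)]
      simp [e₁, e₂, RExpr.eval, IExpr.eval, h.n_eq, hσ, h.B_eq, learningRate]
    have avg3 : τ₃.reg .runningAvg = σ.reg .runningAvg := by
      rw [r3 _ (by decide) (by decide)]; simp [e₁, e₂]
    have sum3 : τ₃.reg .gammaSum = σ.reg .gammaSum := by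
      rw [r3 _ (by decide) (by decide)]; simp [e₁, e₂]
    have val3 : ∀ l < n, τ₃.arr .val l = shiftedCost Y (X i) g l := by
      intro l hl
      rw [v3 l (by simpa [e₁, e₂, h.n_eq] using hl)]
      simp only [e₁, e₂, shiftedCost, hl, dif_pos, h.m_eq, hσ]
      rw [EuclideanSpace.norm_sq_eq, Finset.sum_range]
      congr 1
      · refine Finset.sum_congr rfl fun k _ => ?_
        rw [h.X_eq i hi k, h.Y_eq ⟨l, hl⟩ k]
        simp
      · exact h.g_eq ⟨l, hl⟩
    have exp3 : τ₃.reg .expSum = ∑ t, Real.exp (-lam * g t) := by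
      rw [s3]
      simp only [e₁, e₂, h.n_eq, Finset.sum_range, Function.update_self, RExpr.eval]
      simp [h.lam_eq, h.g_eq, hg]
    -- The machine scans `val` and the rule scans `shiftedCost`. The two agree below `n`, which is
    -- all that a scan of length `n` sees.
    have star5 : τ₅.idx .jstar = (firstArgmin hn Y (X i) g : Fin n) := by
      rw [j5]
      simp only [e₄, firstArgmin]
      simp only [ne_eq, reduceCtorEq, not_false_eq_true, Function.update_of_ne, n3]
      exact scanMin_congr val3
    have val5 : τ₅.arr .val (τ₅.idx .jstar) = ⨅ j, (‖X i - Y j‖ ^ 2 - g j) := by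
      rw [a5, iInf_shiftedCost hJ, star5, e₄, val3 _ (Fin.is_lt _), shiftedCost,
        dif_pos (Fin.is_lt _)]
    have reg5 : τ₅.reg = τ₃.reg := by rw [r5, e₄]
    have arr5 : τ₅.arr = τ₃.arr := by rw [a5, e₄]
    have n5 : τ₅.idx .n = n := by rw [i5 _ (by decide) (by decide)]; simp [e₄, n3]
    have m5 : τ₅.idx .m = m := by rw [i5 _ (by decide) (by decide)]; simp [e₄, m3]
    refine ⟨?_, ?_, ?_, ?_, fun j k => ?_, fun i hi k => ?_, fun j => ?_, ?_, ?_⟩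
    · rw [i8 _ (by decide)]; simp [e₆, e₇, m5]
    · rw [i8 _ (by decide)]; simp [e₆, e₇, n5]
    · rw [r8]; simp [e₆, e₇, reg5, lam3]
    · rw [r8]; simp [e₆, e₇, reg5, B3]
    · rw [a8 _ (by decide)]; simp [e₆, e₇, arr5, Y3, h.Y_eq]
    · rw [a8 _ (by decide)]; simp [e₆, e₇, arr5, X3, h.X_eq i hi]
    · rw [g8 j (by simp [e₆, e₇, n5])]
      simp only [e₆, e₇, arr5, g3, star5, reg5, iterate, ← hg]
      simp [ga3, exp3, lam3, h.g_eq, hg, Fin.ext_iff]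
    · rw [r8, e₇, e₆, Finset.sum_range_succ, ← h.avg_eq]
      simp only [RExpr.eval_hSub, RExpr.eval_hDiv, RExpr.eval, IExpr.eval, val5]
      simp [reg5, avg3, ga3, lam3, exp3, n5, h₁, ← hg, Finset.mul_sum, div_eq_inv_mul]
    · rw [r8, e₇, e₆, Finset.sum_range_succ, ← h.sum_eq]
      simp [RExpr.eval, reg5, sum3, ga3]
  · rw [Nat.mul_add, Nat.mul_add]
    omega

theorem program_spec {m n : ℕ} (hn : 1 ≤ n) {lam B : ℝ} {Y : Fin n → E m}
    {g₀ : Fin n → ℝ} {s : ℕ} (hs : 1 ≤ s) {X : ℕ → E m} {σ : State IVar RVar Arr}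
    (h : HoldsInput lam B Y g₀ s X σ) :
    Spec program σ (fun τ => τ.reg .out = estimate lam B Y (firstArgmin hn Y) g₀ s X ∧
      ∀ j : Fin n, τ.arr .g j = iterate lam B Y (firstArgmin hn Y) g₀ X s j)
      (300 * (m + 1) * n * s) := by
  rw [program_eq]
  refine Spec.mono (Spec.seq (Spec.setReal (Q := fun τ' => τ' = _) rfl) fun τ₁ e₁ => Spec.seq
    (Spec.setReal (Q := fun τ' => τ' = _) rfl) fun τ₂ e₂ => Spec.seq
    ((Spec.loop (fun i τ => AfterSteps lam B Y (firstArgmin hn Y) g₀ s X i τ)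
      (b := 100 + n * (100 + m * 40)) ?_ ?_).mono (b' := 2 + s * (101 + n * (100 + m * 40)))
        (R := AfterSteps lam B Y (firstArgmin hn Y) g₀ s X s) (fun τ h' => ?_) ?_)
    fun τ₃ h₃ => Spec.seq
    (Spec.setReal (Q := fun τ' => τ' = _) rfl) fun τ₄ e₄ => Spec.skip ?_) (fun τ h => h) ?_
  · subst e₁ e₂
    refine ⟨?_, ?_, ?_, ?_, ?_, ?_, ?_, ?_, ?_⟩
    · simp [h.m_eq]
    · simp [h.n_eq]
    · simp [h.lam_eq]
    · simp [h.B_eq]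
    · simp [h.Y_eq]
    · intro i hi k
      simp [h.X_eq i hi]
    · simp [h.g_eq, iterate]
    · simp [RExpr.eval]
    · simp [RExpr.eval]
  · intro i hi τ hτ
    have hi' : i < s := by simpa [IExpr.eval, e₁, e₂, h.s_eq] using hi
    refine stepCmd_spec hn hi' ⟨?_, ?_, hτ.lam_eq, hτ.B_eq, hτ.Y_eq, hτ.X_eq, hτ.g_eq,
      hτ.avg_eq, hτ.sum_eq⟩ (by simp)
    · simp [hτ.m_eq]
    · simp [hτ.n_eq]
  · simpa [IExpr.eval, e₁, e₂, h.s_eq] using h'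
  · simp only [IExpr.cost, IExpr.eval, e₁, e₂, h.s_eq]
    rw [show 100 + n * (100 + m * 40) + 1 = 101 + n * (100 + m * 40) by omega]
    omega
  · subst e₄
    exact ⟨by simp [RExpr.eval, h₃.avg_eq, h₃.sum_eq, estimate], h₃.g_eq⟩
  · simp only [show RExpr.cost (ι := IVar) (ρ := RVar) (α := Arr) (.lit 0) = 1 from rfl,
      show (RExpr.var RVar.runningAvg / RExpr.var RVar.gammaSum :
        RExpr IVar RVar Arr).cost = 3 from rfl]
    -- Step counts that lack the factor `n` or `s` are absorbed because `n` and `s` are at least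
    -- `1`.
    have h1 : 1 ≤ n * s := Nat.mul_pos hn hs
    have h2 : s ≤ n * s := Nat.le_mul_of_pos_left s hn
    have h3 : 0 ≤ m * (n * s) := Nat.zero_le _
    nlinarith

end RSW

namespace RSW

/-! ### The dual objective and truncation of potentials -/

section Potentials

variable {m n : ℕ}

/-- The `c`-transform `min_j (‖x - Y j‖² - g j)`. -/
noncomputable def minCost (Y : Fin n → E m) (x : E m) (g : Fin n → ℝ) : ℝ :=
  ⨅ j, (‖x - Y j‖ ^ 2 - g j)

/-- The normalization `(1/λ) log (∑ t, (1/n) exp (-λ g t))`. -/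
noncomputable def logMeanExp (lam : ℝ) (g : Fin n → ℝ) : ℝ :=
  1 / lam * Real.log (∑ t, 1 / (n : ℝ) * Real.exp (-lam * g t))

theorem h₁_eq (lam : ℝ) (Y : Fin n → E m) (x : E m) (g : Fin n → ℝ) :
    h₁ lam Y x g = minCost Y x g - logMeanExp lam g := rfl

theorem minCost_le (Y : Fin n → E m) (x : E m) (g : Fin n → ℝ) (j : Fin n) :
    minCost Y x g ≤ ‖x - Y j‖ ^ 2 - g j :=
  ciInf_le (Set.finite_range _).bddBelow j

theorem exists_minCost_eq (hn : 1 ≤ n) (Y : Fin n → E m) (x : E m) (g : Fin n → ℝ) :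
    ∃ j, minCost Y x g = ‖x - Y j‖ ^ 2 - g j := by
  have : Nonempty (Fin n) := ⟨⟨0, hn⟩⟩
  obtain ⟨j, hj⟩ := exists_eq_ciInf_of_finite (f := fun j => ‖x - Y j‖ ^ 2 - g j)
  exact ⟨j, hj.symm⟩

theorem measurable_minCost (Y : Fin n → E m) :
    Measurable fun p : E m × (Fin n → ℝ) => minCost Y p.1 p.2 := by
  unfold minCost
  exact Measurable.iInf fun j => by fun_prop

theorem measurable_minCost_left (Y : Fin n → E m) (g : Fin n → ℝ) :
    Measurable fun x => minCost Y x g := by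
  unfold minCost
  exact Measurable.iInf fun j => by fun_prop

theorem measurable_logMeanExp (lam : ℝ) :
    Measurable fun g : Fin n → ℝ => logMeanExp lam g := by
  unfold logMeanExp
  fun_prop

theorem abs_minCost_le (hn : 1 ≤ n) {Y : Fin n → E m} {x : E m} {g : Fin n → ℝ} {K R : ℝ}
    (hK : ∀ j, ‖x - Y j‖ ^ 2 ≤ K) (hR : ∀ j, |g j| ≤ R) : |minCost Y x g| ≤ K + R := by
  obtain ⟨j, hj⟩ := exists_minCost_eq hn Y x g
  have h1 := hK j
  have h2 := abs_le.mp (hR j)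
  rw [hj, abs_le]
  constructor <;> nlinarith [sq_nonneg ‖x - Y j‖]

theorem sum_mean_pos (hn : 1 ≤ n) (lam : ℝ) (g : Fin n → ℝ) :
    0 < ∑ t, 1 / (n : ℝ) * Real.exp (-lam * g t) := by
  have : Nonempty (Fin n) := ⟨⟨0, hn⟩⟩
  have : (0 : ℝ) < n := by exact_mod_cast hn
  exact Finset.sum_pos (fun t _ => by positivity) Finset.univ_nonempty

theorem logMeanExp_mono (hn : 1 ≤ n) {lam : ℝ} (hlam : 0 < lam) {g g' : Fin n → ℝ}
    (h : ∀ j, g j ≤ g' j) : logMeanExp lam g' ≤ logMeanExp lam g := by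
  unfold logMeanExp
  have := sum_mean_pos hn lam g'
  refine mul_le_mul_of_nonneg_left (Real.log_le_log this ?_) (by positivity)
  refine Finset.sum_le_sum fun t _ => ?_
  have := h t
  gcongr ?_ * Real.exp ?_
  nlinarith

theorem logMeanExp_sub_const (hn : 1 ≤ n) {lam : ℝ} (hlam : 0 < lam) (g : Fin n → ℝ) (a : ℝ) :
    logMeanExp lam (fun j => g j - a) = logMeanExp lam g + a := by
  unfold logMeanExp
  have h := sum_mean_pos hn lam g
  have : ∑ t, 1 / (n : ℝ) * Real.exp (-lam * (g t - a))
      = Real.exp (lam * a) * ∑ t, 1 / (n : ℝ) * Real.exp (-lam * g t) := by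
    rw [Finset.mul_sum]
    refine Finset.sum_congr rfl fun t _ => ?_
    rw [show -lam * (g t - a) = lam * a + -lam * g t by ring, Real.exp_add]
    ring
  rw [this, Real.log_mul (Real.exp_ne_zero _) h.ne', Real.log_exp]
  field_simp
  ring

theorem logMeanExp_const (hn : 1 ≤ n) {lam : ℝ} (hlam : 0 < lam) (a : ℝ) :
    logMeanExp lam (fun _ : Fin n => a) = -a := by
  have : (n : ℝ) ≠ 0 := by exact_mod_cast (by omega : n ≠ 0)
  simp [logMeanExp, this]
  field_simp

theorem abs_logMeanExp_le (hn : 1 ≤ n) {lam R : ℝ} (hlam : 0 < lam) {g : Fin n → ℝ}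
    (hR : ∀ j, |g j| ≤ R) : |logMeanExp lam g| ≤ R := by
  have h1 := logMeanExp_mono hn hlam (g := g) (g' := fun _ => R) fun j => (abs_le.mp (hR j)).2
  have h2 := logMeanExp_mono hn hlam (g := fun _ => -R) (g' := g) fun j => (abs_le.mp (hR j)).1
  rw [logMeanExp_const hn hlam] at h1 h2
  exact abs_le.mpr ⟨h1, by simpa using h2⟩

/-- Truncating the potential to an interval of length `K` does not decrease the objective. -/
theorem exists_bounded_potential (hn : 1 ≤ n) {lam K : ℝ} (hlam : 0 < lam) (hK : 0 ≤ K)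
    (Y : Fin n → E m) (g : Fin n → ℝ) :
    ∃ g' : Fin n → ℝ, (∀ j, 0 ≤ g' j ∧ g' j ≤ K) ∧
      ∀ x, (∀ j, ‖x - Y j‖ ^ 2 ≤ K) → h₁ lam Y x g ≤ h₁ lam Y x g' := by
  have : Nonempty (Fin n) := ⟨⟨0, hn⟩⟩
  obtain ⟨k, hk⟩ := Finite.exists_max g
  -- Shift the largest entry to `K`, which leaves `h₁` unchanged, then clip at `0`. Clipping raises
  -- entries and so lowers `logMeanExp`. A clipped index has a nonnegative shifted cost at `x`,
  -- while index `k` already has one that is at most `0`, so the minimum does not drop.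
  refine ⟨fun j => max (g j - (g k - K)) 0, fun j => ⟨le_max_right _ _, ?_⟩, fun x hx => ?_⟩
  · exact max_le (by linarith [hk j]) hK
  · have h1 : logMeanExp lam (fun j => max (g j - (g k - K)) 0)
        ≤ logMeanExp lam g + (g k - K) := by
      rw [← logMeanExp_sub_const hn hlam]
      exact logMeanExp_mono hn hlam fun j => le_max_left _ _
    obtain ⟨j, hj⟩ := exists_minCost_eq hn Y x fun j => max (g j - (g k - K)) 0
    have h2 : minCost Y x g + (g k - K)
        ≤ minCost Y x fun j => max (g j - (g k - K)) 0 := by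
      rw [hj]
      rcases max_cases (g j - (g k - K)) 0 with ⟨h, -⟩ | ⟨h, -⟩
      · rw [h]
        linarith [minCost_le Y x g j]
      · rw [h]
        nlinarith [minCost_le Y x g k, hx k, sq_nonneg ‖x - Y j‖]
    rw [h₁_eq, h₁_eq]
    linarith

end Potentials

/-! ### Weak duality -/

section WeakDuality

variable {m n : ℕ}

theorem wasserstein_two_sq (P Q : Measure (E m)) :
    wasserstein 2 P Q ^ 2 = ⨅ π ∈ couplings P Q, ∫⁻ z, ‖z.1 - z.2‖ₑ ^ 2 ∂π := by
  unfold wasserstein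
  rw [← ENNReal.rpow_natCast, ← ENNReal.rpow_mul]
  norm_num

theorem isProbabilityMeasure_empirical [NeZero n] (Y : Fin n → E m) :
    IsProbabilityMeasure (empirical Y) := by
  refine ⟨?_⟩
  have : (n : ℝ≥0∞) ≠ 0 := by exact_mod_cast NeZero.ne n
  simp [empirical, ENNReal.mul_inv_cancel this (ENNReal.natCast_ne_top n)]

theorem integral_empirical (Y : Fin n → E m) (f : E m → ℝ) :
    ∫ y, f y ∂empirical Y = ∑ j, 1 / (n : ℝ) * f (Y j) := by
  unfold empirical
  rw [integral_finsetSum_measure]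
  · simp
  · intro j _
    rcases Nat.eq_zero_or_pos n with rfl | h
    · exact j.elim0
    · refine (integrable_dirac ?_).smul_measure ?_
      · finiteness
      · simp; omega

theorem ae_empirical_mem_range (Y : Fin n → E m) : ∀ᵐ y ∂empirical Y, y ∈ Set.range Y := by
  have : empirical Y (Set.range Y)ᶜ = 0 := by
    simp [empirical]
  exact this

/-- The potential `g` as a function of the data point. -/
noncomputable def pointPotential (Y : Fin n → E m) (g : Fin n → ℝ) (y : E m) : ℝ :=
  ⨆ j, open Classical in if Y j = y then g j else ⨅ k, g k

theorem measurable_pointPotential (Y : Fin n → E m) (g : Fin n → ℝ) :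
    Measurable (pointPotential Y g) := by
  unfold pointPotential
  refine Measurable.iSup fun j => ?_
  refine Measurable.ite ?_ measurable_const measurable_const
  simp only [eq_comm]
  exact measurableSet_singleton _

theorem le_pointPotential (Y : Fin n → E m) (g : Fin n → ℝ) (j : Fin n) :
    g j ≤ pointPotential Y g (Y j) := by
  refine le_ciSup_of_le (Set.finite_range _).bddAbove j ?_
  simp

/-- Data points may repeat, and the potential at a point is the largest entry among its indices.
Indices of other points contribute only the default `⨅ k, g k`, which exceeds no entry. -/
theorem exists_pointPotential_eq (Y : Fin n → E m) (g : Fin n → ℝ) (j : Fin n) :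
    ∃ k, Y k = Y j ∧ pointPotential Y g (Y j) = g k := by
  have : Nonempty (Fin n) := ⟨j⟩
  obtain ⟨k, hk⟩ := exists_eq_ciSup_of_finite
    (f := fun k => open Classical in if Y k = Y j then g k else ⨅ k, g k)
  change _ = pointPotential Y g (Y j) at hk
  by_cases h : Y k = Y j
  · exact ⟨k, h, by simpa [h] using hk.symm⟩
  · refine ⟨j, rfl, le_antisymm ?_ (le_pointPotential Y g j)⟩
    rw [← hk, if_neg h]
    exact ciInf_le (Set.finite_range _).bddBelow j

theorem abs_pointPotential_le (hn : 1 ≤ n) (Y : Fin n → E m) (g : Fin n → ℝ) :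
    ∃ R, ∀ y, |pointPotential Y g y| ≤ R := by
  have : Nonempty (Fin n) := ⟨⟨0, hn⟩⟩
  obtain ⟨k, hk⟩ := Finite.exists_max fun j => |g j|
  refine ⟨|g k|, fun y => ?_⟩
  obtain ⟨i, hi⟩ := exists_eq_ciInf_of_finite (f := g)
  obtain ⟨j, hj⟩ := exists_eq_ciSup_of_finite
    (f := fun k => open Classical in if Y k = y then g k else ⨅ k, g k)
  rw [pointPotential, ← hj]
  split_ifs
  · exact hk j
  · rw [← hi]
    exact hk i

theorem integrable_pointPotential (hn : 1 ≤ n) (Y : Fin n → E m) (g : Fin n → ℝ)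
    (Q : Measure (E m)) [IsFiniteMeasure Q] : Integrable (pointPotential Y g) Q := by
  obtain ⟨R, hR⟩ := abs_pointPotential_le hn Y g
  exact Integrable.of_bound (measurable_pointPotential Y g).aestronglyMeasurable R
    (ae_of_all _ hR)

/-- Almost every `z.2` is a data point `Y k` whose potential is `g k`, and there `minCost` is at
most the squared distance minus `g k`. Integrating this against the coupling splits the left side
into the two marginals. -/
theorem ofReal_integral_add_le_cost (hn : 1 ≤ n) {Y : Fin n → E m} (g : Fin n → ℝ)
    {P Q : Measure (E m)} [IsProbabilityMeasure P] [IsProbabilityMeasure Q]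
    (hP : Integrable (fun x => minCost Y x g) P) (hQ : Q ≪ empirical Y)
    {π : Measure (E m × E m)} (hπ : π ∈ couplings P Q) :
    ENNReal.ofReal (∫ x, minCost Y x g ∂P + ∫ y, pointPotential Y g y ∂Q)
      ≤ ∫⁻ z, ‖z.1 - z.2‖ₑ ^ 2 ∂π := by
  obtain ⟨h1, h2⟩ := hπ
  have m1 := measurable_minCost_left Y g
  have i1 : Integrable (fun z : E m × E m => minCost Y z.1 g) π := by
    have h : Integrable (fun x => minCost Y x g) (π.map Prod.fst) := by rwa [h1]
    exact h.comp_measurable measurable_fst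
  have i2 : Integrable (fun z : E m × E m => pointPotential Y g z.2) π := by
    have h : Integrable (pointPotential Y g) (π.map Prod.snd) := by
      rw [h2]
      exact integrable_pointPotential hn Y g Q
    exact h.comp_measurable measurable_snd
  have e1 : ∫ x, minCost Y x g ∂P = ∫ z, minCost Y z.1 g ∂π := by
    rw [← h1, integral_map measurable_fst.aemeasurable m1.aestronglyMeasurable]
  have e2 : ∫ y, pointPotential Y g y ∂Q = ∫ z, pointPotential Y g z.2 ∂π := by
    rw [← h2, integral_map measurable_snd.aemeasurable
      (measurable_pointPotential Y g).aestronglyMeasurable]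
  have hae : ∀ᵐ z ∂π, minCost Y z.1 g + pointPotential Y g z.2 ≤ ‖z.1 - z.2‖ ^ 2 := by
    have : ∀ᵐ y ∂Q, y ∈ Set.range Y := hQ.ae_le (ae_empirical_mem_range Y)
    rw [← h2] at this
    filter_upwards [ae_of_ae_map measurable_snd.aemeasurable this] with z hz
    obtain ⟨j, hj⟩ := hz
    obtain ⟨k, hk, hk'⟩ := exists_pointPotential_eq Y g j
    rw [← hj, hk', ← hk]
    linarith [minCost_le Y z.1 g k]
  rw [e1, e2, ← integral_add i1 i2]
  -- The integrand may be negative. Its positive part still lies below the squared distance and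
  -- converts to a lower Lebesgue integral.
  calc _ ≤ ENNReal.ofReal (∫ z, max (minCost Y z.1 g + pointPotential Y g z.2) 0 ∂π) :=
        ENNReal.ofReal_le_ofReal (integral_mono (i1.add i2) (i1.add i2).pos_part
          fun z => le_max_left _ _)
    _ = ∫⁻ z, ENNReal.ofReal (max (minCost Y z.1 g + pointPotential Y g z.2) 0) ∂π :=
        ofReal_integral_eq_lintegral_ofReal (i1.add i2).pos_part
          (ae_of_all _ fun z => le_max_right _ _)
    _ ≤ _ := by
        refine lintegral_mono_ae ?_
        filter_upwards [hae] with z hz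
        rw [← ofReal_norm, ← ENNReal.ofReal_pow (norm_nonneg _)]
        exact ENNReal.ofReal_le_ofReal (max_le hz (sq_nonneg _))

/-- This is the Gibbs variational inequality. The divergence of `Q` from the empirical measure
tilted by `-lam` times the potential is nonnegative; expanding its log-likelihood ratio gives the
claim. -/
theorem ofReal_neg_integral_le_klDiv (hn : 1 ≤ n) {lam : ℝ} (hlam : 0 < lam) (Y : Fin n → E m)
    (g : Fin n → ℝ) {Q : Measure (E m)} [IsProbabilityMeasure Q] (hQ : Q ≪ empirical Y) :
    ENNReal.ofReal (-∫ y, pointPotential Y g y ∂Q - logMeanExp lam g)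
      ≤ ENNReal.ofReal (1 / lam) * InformationTheory.klDiv Q (empirical Y) := by
  have : NeZero n := ⟨by omega⟩
  have := isProbabilityMeasure_empirical Y
  by_cases hi : Integrable (llr Q (empirical Y)) Q
  swap
  · rw [InformationTheory.klDiv_of_not_integrable hi, ENNReal.mul_top]
    · exact le_top
    · simpa using hlam
  have hfin := InformationTheory.klDiv_ne_top hQ hi
  rw [← ENNReal.ofReal_toReal hfin, ← ENNReal.ofReal_mul (by positivity),
    InformationTheory.toReal_klDiv_of_measure_eq hQ (by simp)]
  refine ENNReal.ofReal_le_ofReal ?_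
  have iG := integrable_pointPotential hn Y g Q
  obtain ⟨R, hR⟩ := abs_pointPotential_le hn Y g
  have mf : Measurable fun y => -lam * pointPotential Y g y :=
    (measurable_pointPotential Y g).const_mul _
  have iexp : Integrable (fun y => Real.exp (-lam * pointPotential Y g y)) (empirical Y) := by
    refine Integrable.of_bound (mf.exp).aestronglyMeasurable (Real.exp (lam * R))
      (ae_of_all _ fun y => ?_)
    rw [Real.norm_eq_abs, Real.abs_exp, Real.exp_le_exp]
    nlinarith [(abs_le.mp (hR y)).1]
  have hac : Q ≪ (empirical Y).tilted fun y => -lam * pointPotential Y g y :=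
    hQ.trans (absolutelyContinuous_tilted iexp)
  have : IsProbabilityMeasure ((empirical Y).tilted fun y => -lam * pointPotential Y g y) :=
    isProbabilityMeasure_tilted iexp
  have key := InformationTheory.integral_llr_add_sub_measure_univ_nonneg hac
    (integrable_llr_tilted_right hQ (iG.const_mul _) hi iexp)
  rw [integral_llr_tilted_right hQ (iG.const_mul _) iexp hi, integral_const_mul,
    integral_empirical] at key
  simp only [probReal_univ] at key
  -- With repeated data the potential may exceed `g j` at `Y j`; this only decreases the
  -- normalization.
  have hle : Real.log (∑ j, 1 / (n : ℝ) * Real.exp (-lam * pointPotential Y g (Y j)))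
      ≤ lam * logMeanExp lam g := by
    have := logMeanExp_mono hn hlam (le_pointPotential Y g)
    rw [logMeanExp, one_div_mul_eq_div, div_le_iff₀ hlam] at this
    linarith
  rw [one_div_mul_eq_div, le_div_iff₀ hlam]
  nlinarith

/-- Weak duality. -/
theorem ofReal_integral_h₁_le_rsw (hn : 1 ≤ n) {lam : ℝ} (hlam : 0 < lam) {Y : Fin n → E m}
    (g : Fin n → ℝ) {P : Measure (E m)} [IsProbabilityMeasure P]
    (hP : Integrable (fun x => minCost Y x g) P) :
    ENNReal.ofReal (∫ x, h₁ lam Y x g ∂P) ≤ rsw lam (empirical Y) P := by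
  unfold rsw
  refine le_iInf₂ fun Q hQ => ?_
  obtain ⟨hQ1, hQ2⟩ := hQ
  have e : ∫ x, h₁ lam Y x g ∂P = (-∫ y, pointPotential Y g y ∂Q - logMeanExp lam g)
      + (∫ x, minCost Y x g ∂P + ∫ y, pointPotential Y g y ∂Q) := by
    simp only [h₁_eq]
    rw [integral_sub hP (integrable_const _)]
    simp
    ring
  rw [e, wasserstein_two_sq]
  -- `ENNReal.ofReal` is subadditive for all signs, so neither summand has to be nonnegative.
  refine ENNReal.ofReal_add_le.trans (add_le_add (ofReal_neg_integral_le_klDiv hn hlam Y g hQ2) ?_)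
  exact le_iInf₂ fun π hπ => ofReal_integral_add_le_cost hn g hP hQ2 hπ

end WeakDuality

end RSW

namespace RSW

/-! ### The entropically smoothed dual and its maximizer -/

section SmoothedDual

variable {n : ℕ} {β : Type*}

/-- The partition function of the soft assignment at temperature `ε`. -/
noncomputable def partition (ε : ℝ) (c : Fin n → β → ℝ) (g : Fin n → ℝ) (x : β) : ℝ :=
  ∑ j, Real.exp ((g j - c j x) / ε)

/-- The soft assignment at temperature `ε`. -/
noncomputable def softAssign (ε : ℝ) (c : Fin n → β → ℝ) (g : Fin n → ℝ) (j : Fin n) (x : β) : ℝ :=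
  Real.exp ((g j - c j x) / ε) / partition ε c g x

theorem partition_pos (hn : 1 ≤ n) (ε : ℝ) (c : Fin n → β → ℝ) (g : Fin n → ℝ) (x : β) :
    0 < partition ε c g x := by
  have : Nonempty (Fin n) := ⟨⟨0, hn⟩⟩
  exact Finset.sum_pos (fun _ _ => Real.exp_pos _) Finset.univ_nonempty

theorem exp_le_partition (ε : ℝ) (c : Fin n → β → ℝ) (g : Fin n → ℝ) (x : β) (j : Fin n) :
    Real.exp ((g j - c j x) / ε) ≤ partition ε c g x :=
  Finset.single_le_sum (f := fun j => Real.exp ((g j - c j x) / ε))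
    (fun _ _ => (Real.exp_pos _).le) (Finset.mem_univ j)

theorem le_log_partition (ε : ℝ) (c : Fin n → β → ℝ) (g : Fin n → ℝ) (x : β) (j : Fin n) :
    (g j - c j x) / ε ≤ Real.log (partition ε c g x) := by
  rw [← Real.log_exp ((g j - c j x) / ε)]
  exact Real.log_le_log (Real.exp_pos _) (exp_le_partition ε c g x j)

theorem log_partition_le (hn : 1 ≤ n) {ε : ℝ} (hε : 0 < ε) {c : Fin n → β → ℝ} {g : Fin n → ℝ}
    {x : β} {R : ℝ} (hc : ∀ j, 0 ≤ c j x) (hg : ∀ j, g j ≤ R) :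
    Real.log (partition ε c g x) ≤ R / ε + Real.log n := by
  have hn' : (0 : ℝ) < n := by exact_mod_cast hn
  have : partition ε c g x ≤ n * Real.exp (R / ε) := by
    unfold partition
    refine (Finset.sum_le_card_nsmul _ _ (Real.exp (R / ε)) fun j _ => ?_).trans (by simp)
    rw [Real.exp_le_exp]
    gcongr
    linarith [hc j, hg j]
  refine (Real.log_le_log (partition_pos hn _ _ _ _) this).trans ?_
  rw [Real.log_mul hn'.ne' (Real.exp_ne_zero _), Real.log_exp, add_comm]

theorem abs_log_partition_le (hn : 1 ≤ n) {ε : ℝ} (hε : 0 < ε) {c : Fin n → β → ℝ}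
    {g : Fin n → ℝ} {x : β} {K R : ℝ} (hc : ∀ j, 0 ≤ c j x ∧ c j x ≤ K)
    (hg : ∀ j, |g j| ≤ R) :
    |Real.log (partition ε c g x)| ≤ (R + K) / ε + Real.log n := by
  have hn' : (1 : ℝ) ≤ n := by exact_mod_cast hn
  have hlog := Real.log_nonneg hn'
  have h1 := log_partition_le hn hε (fun j => (hc j).1) fun j => (abs_le.mp (hg j)).2
  have h2 := le_log_partition ε c g x ⟨0, hn⟩
  have h3 : -((R + K) / ε) ≤ (g ⟨0, hn⟩ - c ⟨0, hn⟩ x) / ε := by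
    rw [← neg_div]
    gcongr
    linarith [(hc ⟨0, hn⟩).2, (abs_le.mp (hg ⟨0, hn⟩)).1]
  have h4 : R / ε ≤ (R + K) / ε := by
    gcongr
    linarith [(hc ⟨0, hn⟩).1, (hc ⟨0, hn⟩).2]
  rw [abs_le]
  constructor <;> linarith

theorem softAssign_nonneg (hn : 1 ≤ n) (ε : ℝ) (c : Fin n → β → ℝ) (g : Fin n → ℝ) (j : Fin n)
    (x : β) : 0 ≤ softAssign ε c g j x :=
  div_nonneg (Real.exp_pos _).le (partition_pos hn _ _ _ _).le

theorem softAssign_le_one (hn : 1 ≤ n) (ε : ℝ) (c : Fin n → β → ℝ) (g : Fin n → ℝ) (j : Fin n)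
    (x : β) : softAssign ε c g j x ≤ 1 :=
  div_le_one_of_le₀ (exp_le_partition _ _ _ _ _) (partition_pos hn _ _ _ _).le

theorem sum_softAssign (hn : 1 ≤ n) (ε : ℝ) (c : Fin n → β → ℝ) (g : Fin n → ℝ) (x : β) :
    ∑ j, softAssign ε c g j x = 1 := by
  unfold softAssign
  rw [← Finset.sum_div]
  exact div_self (partition_pos hn _ _ _ _).ne'

/-- The soft assignment is almost optimal for the `c`-transform. -/
theorem sum_softAssign_mul_le (hn : 1 ≤ n) {ε : ℝ} (hε : 0 < ε) (c : Fin n → β → ℝ)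
    (g : Fin n → ℝ) (x : β) (k : Fin n) :
    ∑ j, softAssign ε c g j x * (c j x - g j) ≤ c k x - g k + n * ε := by
  -- An index whose shifted cost exceeds that of `k` by `t > 0` has weight at most `exp (-t / ε)`,
  -- and `t * exp (-t / ε) ≤ ε`. Summing over `n` indices produces `n * ε`.
  have key : ∀ j, softAssign ε c g j x * (c j x - g j - (c k x - g k)) ≤ ε := by
    intro j
    set t := c j x - g j - (c k x - g k) with ht
    rcases le_or_gt t 0 with h | h
    · exact (mul_nonpos_of_nonneg_of_nonpos (softAssign_nonneg hn _ _ _ _ _) h).trans hε.le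
    · have h1 : softAssign ε c g j x ≤ Real.exp (-(t / ε)) := by
        unfold softAssign
        rw [div_le_iff₀ (partition_pos hn _ _ _ _)]
        refine le_trans (le_of_eq ?_) (mul_le_mul_of_nonneg_left
          (exp_le_partition ε c g x k) (Real.exp_pos _).le)
        rw [← Real.exp_add, ht]
        congr 1
        field_simp
        ring
      have h2 : t ≤ ε * Real.exp (t / ε) := by
        have := Real.add_one_le_exp (t / ε)
        calc t = ε * (t / ε) := by field_simp
          _ ≤ _ := by gcongr; linarith
      calc _ ≤ Real.exp (-(t / ε)) * t := by gcongr
        _ ≤ Real.exp (-(t / ε)) * (ε * Real.exp (t / ε)) := by gcongr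
        _ = ε := by rw [Real.exp_neg]; field_simp
  have h := Finset.sum_le_sum fun j (_ : j ∈ Finset.univ) => key j
  simp only [mul_sub _ _ (c k x - g k), Finset.sum_sub_distrib, ← Finset.sum_mul,
    sum_softAssign hn] at h
  simp at h
  linarith

theorem partition_add_single (ε : ℝ) (c : Fin n → β → ℝ) (g : Fin n → ℝ) (j : Fin n) (t : ℝ)
    (x : β) : partition ε c (g + Pi.single j t) x
      = partition ε c g x + (Real.exp (t / ε) - 1) * Real.exp ((g j - c j x) / ε) := by
  unfold partition
  rw [← Finset.add_sum_erase _ _ (Finset.mem_univ j), ← Finset.add_sum_erase _ _ (Finset.mem_univ j)]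
  have : ∑ k ∈ Finset.univ.erase j, Real.exp (((g + Pi.single j t : Fin n → ℝ) k - c k x) / ε)
      = ∑ k ∈ Finset.univ.erase j, Real.exp ((g k - c k x) / ε) :=
    Finset.sum_congr rfl fun k hk => by simp [Finset.ne_of_mem_erase hk]
  rw [this]
  simp only [Pi.add_apply, Pi.single_eq_same]
  rw [show (g j + t - c j x) / ε = t / ε + (g j - c j x) / ε by ring, Real.exp_add]
  ring

theorem hasDerivAt_log_partition (hn : 1 ≤ n) (ε : ℝ) (c : Fin n → β → ℝ) (g : Fin n → ℝ)
    (j : Fin n) (t : ℝ) (x : β) :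
    HasDerivAt (fun t => Real.log (partition ε c (g + Pi.single j t) x))
      (softAssign ε c (g + Pi.single j t) j x / ε) t := by
  have h1 : HasDerivAt (fun t => partition ε c (g + Pi.single j t) x)
      (Real.exp (t / ε) * (1 / ε) * Real.exp ((g j - c j x) / ε)) t := by
    simp only [partition_add_single]
    exact ((((hasDerivAt_id t).div_const ε).exp.sub_const 1).mul_const _).const_add _
  convert h1.log (partition_pos hn _ _ _ _).ne' using 1
  simp only [softAssign, Pi.add_apply, Pi.single_eq_same]
  rw [show (g j + t - c j x) / ε = t / ε + (g j - c j x) / ε by ring, Real.exp_add]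
  ring

variable [MeasurableSpace β]

theorem measurable_partition (ε : ℝ) {c : Fin n → β → ℝ} (hc : ∀ j, Measurable (c j))
    (g : Fin n → ℝ) : Measurable (partition ε c g) := by
  unfold partition
  fun_prop

theorem measurable_softAssign (ε : ℝ) {c : Fin n → β → ℝ} (hc : ∀ j, Measurable (c j))
    (g : Fin n → ℝ) (j : Fin n) : Measurable (softAssign ε c g j) := by
  have := measurable_partition ε hc g
  unfold softAssign
  fun_prop

/-- The smoothed dual objective. -/
noncomputable def smoothDual (lam ε : ℝ) (c : Fin n → β → ℝ) (P : Measure β) (g : Fin n → ℝ) : ℝ :=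
  -ε * ∫ x, Real.log (partition ε c g x) ∂P - logMeanExp lam g

variable {lam ε K : ℝ} {c : Fin n → β → ℝ} {P : Measure β} [IsProbabilityMeasure P]

theorem integrable_log_partition (hn : 1 ≤ n) (hε : 0 < ε) (hc : ∀ j, Measurable (c j))
    (hcK : ∀ᵐ x ∂P, ∀ j, 0 ≤ c j x ∧ c j x ≤ K) (g : Fin n → ℝ) :
    Integrable (fun x => Real.log (partition ε c g x)) P := by
  have : Nonempty (Fin n) := ⟨⟨0, hn⟩⟩
  obtain ⟨k, hk⟩ := Finite.exists_max fun j => |g j|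
  refine Integrable.of_bound (measurable_partition ε hc g).log.aestronglyMeasurable
    ((|g k| + K) / ε + Real.log n) ?_
  filter_upwards [hcK] with x hx
  exact abs_log_partition_le hn hε hx hk

theorem continuousOn_smoothDual (hn : 1 ≤ n) (hε : 0 < ε) (hc : ∀ j, Measurable (c j))
    (hcK : ∀ᵐ x ∂P, ∀ j, 0 ≤ c j x ∧ c j x ≤ K) (R : ℝ) :
    ContinuousOn (smoothDual lam ε c P) (Set.Icc 0 fun _ => R) := by
  unfold smoothDual
  refine ContinuousOn.sub (ContinuousOn.mul continuousOn_const ?_) ?_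
  · refine continuousOn_of_dominated (bound := fun _ => (R + K) / ε + Real.log n) ?_ ?_
      (integrable_const _) ?_
    · exact fun g _ => (measurable_partition ε hc g).log.aestronglyMeasurable
    · intro g hg
      filter_upwards [hcK] with x hx
      refine abs_log_partition_le hn hε hx fun j => ?_
      rw [abs_of_nonneg (hg.1 j)]
      exact hg.2 j
    · refine ae_of_all _ fun x => Continuous.continuousOn ?_
      refine Continuous.log ?_ fun g => (partition_pos hn _ _ _ _).ne'
      unfold partition
      fun_prop
  · refine Continuous.continuousOn ?_
    unfold logMeanExp
    refine continuous_const.mul (Continuous.log (by fun_prop) fun g => (sum_mean_pos hn lam g).ne')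

theorem smoothDual_sub_const (hn : 1 ≤ n) (hlam : 0 < lam) (hε : 0 < ε)
    (hc : ∀ j, Measurable (c j)) (hcK : ∀ᵐ x ∂P, ∀ j, 0 ≤ c j x ∧ c j x ≤ K) (g : Fin n → ℝ)
    (a : ℝ) : smoothDual lam ε c P (fun j => g j - a) = smoothDual lam ε c P g := by
  unfold smoothDual
  have : ∀ x, Real.log (partition ε c (fun j => g j - a) x)
      = Real.log (partition ε c g x) - a / ε := by
    intro x
    have : partition ε c (fun j => g j - a) x = partition ε c g x * Real.exp (-(a / ε)) := by
      unfold partition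
      rw [Finset.sum_mul]
      refine Finset.sum_congr rfl fun j _ => ?_
      rw [← Real.exp_add]
      ring_nf
    rw [this, Real.log_mul (partition_pos hn _ _ _ _).ne' (Real.exp_ne_zero _), Real.log_exp]
    ring
  simp only [this]
  rw [integral_sub (integrable_log_partition hn hε hc hcK g) (integrable_const _),
    logMeanExp_sub_const hn hlam]
  simp
  field_simp
  ring

/-- Coercivity: the term of index `j` alone bounds the log-partition function from below, and the
term of index `k` alone bounds the sum in `logMeanExp` below by `1 / n`. -/
theorem smoothDual_le (hn : 1 ≤ n) (hlam : 0 < lam) (hε : 0 < ε) (hc : ∀ j, Measurable (c j))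
    (hcK : ∀ᵐ x ∂P, ∀ j, 0 ≤ c j x ∧ c j x ≤ K) {g : Fin n → ℝ} {k : Fin n} (hk : g k = 0)
    (j : Fin n) : smoothDual lam ε c P g ≤ K - g j + Real.log n / lam := by
  have h1 : (g j - K) / ε ≤ ∫ x, Real.log (partition ε c g x) ∂P := by
    have := integral_mono_ae (integrable_const ((g j - K) / ε))
      (integrable_log_partition hn hε hc hcK g) (by
        filter_upwards [hcK] with x hx
        refine le_trans ?_ (le_log_partition ε c g x j)
        gcongr
        exact (hx j).2)
    simpa using this
  rw [div_le_iff₀ hε] at h1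
  have h2 : -(Real.log n / lam) ≤ logMeanExp lam g := by
    have hn' : (0 : ℝ) < n := by exact_mod_cast hn
    have : 1 / (n : ℝ) ≤ ∑ t, 1 / (n : ℝ) * Real.exp (-lam * g t) := by
      refine le_trans (le_of_eq ?_) (Finset.single_le_sum
        (f := fun t => 1 / (n : ℝ) * Real.exp (-lam * g t)) (fun t _ => by positivity)
        (Finset.mem_univ k))
      simp [hk]
    have := Real.log_le_log (by positivity) this
    rw [show Real.log (1 / (n : ℝ)) = -Real.log n by rw [one_div, Real.log_inv]] at this
    rw [logMeanExp, one_div_mul_eq_div, ← neg_div]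
    gcongr
  unfold smoothDual
  linarith

theorem le_smoothDual_zero (hn : 1 ≤ n) (hlam : 0 < lam) (hε : 0 < ε) (hc : ∀ j, Measurable (c j))
    (hcK : ∀ᵐ x ∂P, ∀ j, 0 ≤ c j x ∧ c j x ≤ K) :
    -(ε * Real.log n) ≤ smoothDual lam ε c P 0 := by
  have h1 : ∫ x, Real.log (partition ε c 0 x) ∂P ≤ Real.log n := by
    have := integral_mono_ae (integrable_log_partition hn hε hc hcK 0)
      (integrable_const (Real.log n)) (by
        filter_upwards [hcK] with x hx
        simpa using log_partition_le hn hε (g := 0) (R := 0) (fun j => (hx j).1) (by simp))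
    simpa using this
  have h2 : logMeanExp lam (0 : Fin n → ℝ) = 0 := by
    simpa [Pi.zero_def] using logMeanExp_const (n := n) hn hlam 0
  unfold smoothDual
  rw [h2]
  nlinarith

/-- Translation invariance allows the smallest entry to be `0`. Coercivity then confines the search
to a compact box, where continuity yields a maximizer. -/
theorem exists_forall_smoothDual_le (hn : 1 ≤ n) (hlam : 0 < lam) (hε : 0 < ε)
    (hc : ∀ j, Measurable (c j)) (hcK : ∀ᵐ x ∂P, ∀ j, 0 ≤ c j x ∧ c j x ≤ K) :
    ∃ g, ∀ g', smoothDual lam ε c P g' ≤ smoothDual lam ε c P g := by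
  have : Nonempty (Fin n) := ⟨⟨0, hn⟩⟩
  have hn' : (1 : ℝ) ≤ n := by exact_mod_cast hn
  have hlog := Real.log_nonneg hn'
  have hK : 0 ≤ K := by
    obtain ⟨x, hx⟩ := hcK.exists
    exact (hx ⟨0, hn⟩).1.trans (hx ⟨0, hn⟩).2
  -- Beyond this `R` the upper bound `smoothDual_le` falls below the value guaranteed at the zero
  -- potential.
  set R := K + Real.log n / lam + ε * Real.log n with hR
  have hR0 : 0 ≤ R := by positivity
  have h0 : (0 : Fin n → ℝ) ∈ Set.Icc (0 : Fin n → ℝ) fun _ => R :=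
    ⟨le_rfl, fun _ => hR0⟩
  obtain ⟨g, -, hmax⟩ := (isCompact_Icc).exists_isMaxOn ⟨0, h0⟩
    (continuousOn_smoothDual (lam := lam) hn hε hc hcK R)
  refine ⟨g, fun g' => ?_⟩
  obtain ⟨k, hk⟩ := Finite.exists_min g'
  rw [← smoothDual_sub_const hn hlam hε hc hcK g' (g' k)]
  by_cases h : ∀ j, g' j - g' k ≤ R
  · exact hmax ⟨fun j => sub_nonneg.mpr (hk j), h⟩
  · push Not at h
    obtain ⟨j, hj⟩ := h
    have h1 := smoothDual_le hn hlam hε hc hcK (g := fun j => g' j - g' k) (sub_self (g' k)) j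
    have h2 := le_smoothDual_zero hn hlam hε hc hcK
    have h3 := hmax h0
    simp only [Set.mem_ofPred_eq] at h3
    linarith

theorem hasDerivAt_logMeanExp (hn : 1 ≤ n) (hlam : 0 < lam) (g : Fin n → ℝ) (j : Fin n) :
    HasDerivAt (fun t => logMeanExp lam (g + Pi.single j t))
      (-(Real.exp (-lam * g j) / ∑ l, Real.exp (-lam * g l))) 0 := by
  have hn' : (0 : ℝ) < n := by exact_mod_cast hn
  have e : ∀ t, ∑ l, 1 / (n : ℝ) * Real.exp (-lam * (g + Pi.single j t : Fin n → ℝ) l)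
      = ∑ l, 1 / (n : ℝ) * Real.exp (-lam * g l)
        + (Real.exp (-lam * t) - 1) * (1 / (n : ℝ) * Real.exp (-lam * g j)) := by
    intro t
    rw [← Finset.add_sum_erase _ _ (Finset.mem_univ j),
      ← Finset.add_sum_erase (a := j) _ (fun l => 1 / (n : ℝ) * Real.exp (-lam * g l))
        (Finset.mem_univ j)]
    have : ∑ k ∈ Finset.univ.erase j, 1 / (n : ℝ) *
          Real.exp (-lam * (g + Pi.single j t : Fin n → ℝ) k)
        = ∑ k ∈ Finset.univ.erase j, 1 / (n : ℝ) * Real.exp (-lam * g k) :=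
      Finset.sum_congr rfl fun k hk => by simp [Finset.ne_of_mem_erase hk]
    rw [this]
    simp only [Pi.add_apply, Pi.single_eq_same, mul_add, Real.exp_add]
    ring
  have hpos := sum_mean_pos hn lam g
  have h1 : HasDerivAt
      (fun t => ∑ l, 1 / (n : ℝ) * Real.exp (-lam * (g + Pi.single j t : Fin n → ℝ) l))
      (Real.exp (-lam * 0) * (-lam * 1) * (1 / (n : ℝ) * Real.exp (-lam * g j))) 0 := by
    simp only [e]
    exact ((((hasDerivAt_id (0 : ℝ)).const_mul (-lam)).exp.sub_const 1).mul_const _).const_add _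
  have h2 := (h1.log (by simpa using hpos.ne')).const_mul (1 / lam)
  refine h2.congr_deriv ?_
  simp only [← Finset.mul_sum, Pi.single_zero, add_zero] at hpos ⊢
  have : 0 < ∑ l, Real.exp (-lam * g l) := by
    have : Nonempty (Fin n) := ⟨j⟩
    exact Finset.sum_pos (fun _ _ => Real.exp_pos _) Finset.univ_nonempty
  simp
  field_simp

/-- The first order condition for a maximizer of the smoothed dual objective. -/
theorem exists_integral_softAssign_eq (hn : 1 ≤ n) (hlam : 0 < lam) (hε : 0 < ε)
    (hc : ∀ j, Measurable (c j)) (hcK : ∀ᵐ x ∂P, ∀ j, 0 ≤ c j x ∧ c j x ≤ K) :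
    ∃ g, ∀ j, ∫ x, softAssign ε c g j x ∂P
      = Real.exp (-lam * g j) / ∑ l, Real.exp (-lam * g l) := by
  obtain ⟨g, hg⟩ := exists_forall_smoothDual_le (lam := lam) hn hlam hε hc hcK
  refine ⟨g, fun j => ?_⟩
  -- Derivatives along coordinate directions suffice. Differentiation under the integral is
  -- dominated by `1 / ε`, as soft assignments lie in `[0, 1]`.
  have h1 : HasDerivAt (fun t => ∫ x, Real.log (partition ε c (g + Pi.single j t) x) ∂P)
      (∫ x, softAssign ε c (g + Pi.single j 0) j x / ε ∂P) 0 := by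
    refine (hasDerivAt_integral_of_dominated_loc_of_deriv_le (bound := fun _ => 1 / ε)
      (F' := fun t x => softAssign ε c (g + Pi.single j t) j x / ε)
      (s := Set.univ) Filter.univ_mem ?_ ?_ ?_ ?_ ?_ ?_).2
    · exact Filter.Eventually.of_forall fun t =>
        (measurable_partition ε hc _).log.aestronglyMeasurable
    · exact integrable_log_partition hn hε hc hcK _
    · exact ((measurable_softAssign ε hc _ j).div_const _).aestronglyMeasurable
    · refine ae_of_all _ fun x t _ => ?_
      rw [Real.norm_of_nonneg (div_nonneg (softAssign_nonneg hn _ _ _ _ _) hε.le)]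
      gcongr
      exact softAssign_le_one hn _ _ _ _ _
    · exact integrable_const _
    · exact ae_of_all _ fun x t _ => hasDerivAt_log_partition hn ε c g j t x
  have h2 : HasDerivAt (fun t => smoothDual lam ε c P (g + Pi.single j t))
      (-ε * (∫ x, softAssign ε c (g + Pi.single j 0) j x / ε ∂P)
        - -(Real.exp (-lam * g j) / ∑ l, Real.exp (-lam * g l))) 0 := by
    unfold smoothDual
    exact (h1.const_mul (-ε)).sub (hasDerivAt_logMeanExp hn hlam g j)
  have hmax : IsLocalMax (fun t => smoothDual lam ε c P (g + Pi.single j t)) 0 :=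
    Filter.Eventually.of_forall fun t => by simpa using hg _
  have h3 := hmax.hasDerivAt_eq_zero h2
  simp only [Pi.single_zero, add_zero, integral_div] at h3
  have : -ε * ((∫ x, softAssign ε c g j x ∂P) / ε) = -∫ x, softAssign ε c g j x ∂P := by
    field_simp
  linarith

end SmoothedDual

end RSW

namespace RSW

/-! ### Approximate strong duality from an explicit coupling -/

section StrongDuality

variable {m n : ℕ}

/-- The coupling that sends the fraction `p j x` of the mass at `x` to `Y j`. -/
noncomputable def assignCoupling (Y : Fin n → E m) (p : Fin n → E m → ℝ) (P : Measure (E m)) :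
    Measure (E m × E m) :=
  ∑ j, (P.withDensity fun x => ENNReal.ofReal (p j x)).map fun x => (x, Y j)

variable {Y : Fin n → E m} {p : Fin n → E m → ℝ} {P : Measure (E m)}

theorem map_fst_assignCoupling (hp : ∀ j, Measurable (p j)) (hp0 : ∀ j x, 0 ≤ p j x)
    (hp1 : ∀ x, ∑ j, p j x = 1) : (assignCoupling Y p P).map Prod.fst = P := by
  ext s hs
  have : ∀ j, Measurable fun x => ENNReal.ofReal (p j x) := fun j => (hp j).ennreal_ofReal
  rw [assignCoupling, Measure.map_apply measurable_fst hs, Measure.finsetSum_apply]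
  have h : ∀ j, ((P.withDensity fun x => ENNReal.ofReal (p j x)).map fun x => (x, Y j))
      (Prod.fst ⁻¹' s) = ∫⁻ x in s, ENNReal.ofReal (p j x) ∂P := by
    intro j
    rw [Measure.map_apply (by fun_prop) (measurable_fst hs), ← withDensity_apply _ hs]
    rfl
  simp only [h]
  rw [← lintegral_finsetSum _ fun j _ => this j]
  simp_rw [← ENNReal.ofReal_sum_of_nonneg fun j _ => hp0 j _, hp1]
  simp

theorem map_snd_assignCoupling_apply {s : Set (E m)} (hs : MeasurableSet s)
    (hpi : ∀ j, Integrable (p j) P) (hp0 : ∀ j x, 0 ≤ p j x) :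
    (assignCoupling Y p P).map Prod.snd s
      = ∑ j, s.indicator (fun _ => ENNReal.ofReal (∫ x, p j x ∂P)) (Y j) := by
  rw [assignCoupling, Measure.map_apply measurable_snd hs, Measure.finsetSum_apply]
  refine Finset.sum_congr rfl fun j _ => ?_
  rw [Measure.map_apply (by fun_prop) (measurable_snd hs)]
  by_cases h : Y j ∈ s
  · have : (fun x : E m => (x, Y j)) ⁻¹' (Prod.snd ⁻¹' s) = Set.univ := by ext; simp [h]
    rw [this, withDensity_apply _ MeasurableSet.univ, Measure.restrict_univ,
      Set.indicator_of_mem h, ofReal_integral_eq_lintegral_ofReal (hpi j) (ae_of_all _ (hp0 j))]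
  · have : (fun x : E m => (x, Y j)) ⁻¹' (Prod.snd ⁻¹' s) = ∅ := by ext; simp [h]
    rw [this, measure_empty, Set.indicator_of_notMem h]

theorem lintegral_assignCoupling (hp : ∀ j, Measurable (p j)) (hp0 : ∀ j x, 0 ≤ p j x)
    (hi : ∀ j, Integrable (fun x => p j x * ‖x - Y j‖ ^ 2) P) :
    ∫⁻ z, ‖z.1 - z.2‖ₑ ^ 2 ∂assignCoupling Y p P
      = ENNReal.ofReal (∑ j, ∫ x, p j x * ‖x - Y j‖ ^ 2 ∂P) := by
  have h0 : ∀ j x, 0 ≤ p j x * ‖x - Y j‖ ^ 2 := fun j x => mul_nonneg (hp0 j x) (sq_nonneg _)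
  rw [assignCoupling, lintegral_finsetSum_measure,
    ENNReal.ofReal_sum_of_nonneg fun j _ => integral_nonneg (h0 j)]
  refine Finset.sum_congr rfl fun j _ => ?_
  rw [lintegral_map (by fun_prop) (by fun_prop),
    lintegral_withDensity_eq_lintegral_mul _ (hp j).ennreal_ofReal (by fun_prop),
    ofReal_integral_eq_lintegral_ofReal (hi j) (ae_of_all _ (h0 j))]
  refine lintegral_congr fun x => ?_
  rw [Pi.mul_apply, ENNReal.ofReal_mul (hp0 j x), ENNReal.ofReal_pow (norm_nonneg _), ofReal_norm]

/-- The Gibbs measure of the potential `g`. -/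
noncomputable def gibbs (lam : ℝ) (Y : Fin n → E m) (g : Fin n → ℝ) : Measure (E m) :=
  (empirical Y).tilted fun y => -lam * pointPotential Y g y

variable {lam : ℝ} {g : Fin n → ℝ}

theorem integrable_empirical (hn : 1 ≤ n) (Y : Fin n → E m) (f : E m → ℝ) :
    Integrable f (empirical Y) := by
  unfold empirical
  rw [integrable_finsetSum_measure]
  intro j _
  refine (integrable_dirac (by simp)).smul_measure ?_
  simp
  omega

theorem integral_exp_pointPotential (hG : ∀ j, pointPotential Y g (Y j) = g j) :
    ∫ y, Real.exp (-lam * pointPotential Y g y) ∂empirical Y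
      = ∑ t, 1 / (n : ℝ) * Real.exp (-lam * g t) := by
  rw [integral_empirical]
  simp only [hG]

theorem isProbabilityMeasure_gibbs (hn : 1 ≤ n) (lam : ℝ) (Y : Fin n → E m) (g : Fin n → ℝ) :
    IsProbabilityMeasure (gibbs lam Y g) := by
  have : NeZero n := ⟨by omega⟩
  have := isProbabilityMeasure_empirical Y
  exact isProbabilityMeasure_tilted (integrable_empirical hn Y _)

theorem exp_div_sum_mean (hn : 1 ≤ n) (lam : ℝ) (g : Fin n → ℝ) (j : Fin n) :
    1 / (n : ℝ) * (Real.exp (-lam * g j) / ∑ t, 1 / (n : ℝ) * Real.exp (-lam * g t))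
      = Real.exp (-lam * g j) / ∑ l, Real.exp (-lam * g l) := by
  have hn' : (n : ℝ) ≠ 0 := by exact_mod_cast (by omega : n ≠ 0)
  rw [← Finset.mul_sum]
  field_simp

theorem integral_gibbs (hn : 1 ≤ n) (hG : ∀ j, pointPotential Y g (Y j) = g j) (φ : E m → ℝ) :
    ∫ y, φ y ∂gibbs lam Y g
      = ∑ j, Real.exp (-lam * g j) / (∑ l, Real.exp (-lam * g l)) * φ (Y j) := by
  rw [gibbs, integral_tilted, integral_exp_pointPotential hG, integral_empirical]
  refine Finset.sum_congr rfl fun j _ => ?_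
  rw [hG, ← exp_div_sum_mean hn, smul_eq_mul, mul_assoc]

theorem gibbs_apply (hn : 1 ≤ n) (hG : ∀ j, pointPotential Y g (Y j) = g j) {s : Set (E m)}
    (hs : MeasurableSet s) : gibbs lam Y g s = ∑ j, s.indicator
      (fun _ => ENNReal.ofReal (Real.exp (-lam * g j) / ∑ l, Real.exp (-lam * g l))) (Y j) := by
  have hn' : (0 : ℝ) < n := by exact_mod_cast hn
  have hmeas := measurable_pointPotential Y g
  have hm : Measurable fun a => ENNReal.ofReal (Real.exp (-lam * pointPotential Y g a)
      / ∑ t, 1 / (n : ℝ) * Real.exp (-lam * g t)) := by fun_prop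
  rw [gibbs, tilted_apply' _ _ hs, integral_exp_pointPotential hG, ← lintegral_indicator hs]
  conv_lhs => rw [empirical]
  rw [lintegral_finsetSum_measure]
  refine Finset.sum_congr rfl fun j _ => ?_
  rw [lintegral_smul_measure, lintegral_dirac' _ (hm.indicator hs)]
  by_cases h : Y j ∈ s
  · rw [Set.indicator_of_mem h, Set.indicator_of_mem h, hG, ← exp_div_sum_mean hn,
      ENNReal.ofReal_mul (by positivity), one_div, ENNReal.ofReal_inv_of_pos hn',
      ENNReal.ofReal_natCast, smul_eq_mul]
  · simp [h]

/-- The log-density of the Gibbs measure is affine in the potential, so its mean is explicit.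
Nonnegativity is recorded because `ENNReal.ofReal` would otherwise lose the value. -/
theorem klDiv_gibbs (hn : 1 ≤ n) (hlam : 0 < lam) (hG : ∀ j, pointPotential Y g (Y j) = g j) :
    0 ≤ -∑ j, Real.exp (-lam * g j) / (∑ l, Real.exp (-lam * g l)) * g j - logMeanExp lam g ∧
    ENNReal.ofReal (1 / lam) * InformationTheory.klDiv (gibbs lam Y g) (empirical Y)
      = ENNReal.ofReal (-∑ j, Real.exp (-lam * g j) / (∑ l, Real.exp (-lam * g l)) * g j
        - logMeanExp lam g) := by
  have : NeZero n := ⟨by omega⟩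
  have := isProbabilityMeasure_empirical Y
  have := isProbabilityMeasure_gibbs hn lam Y g
  have hac : gibbs lam Y g ≪ empirical Y := tilted_absolutelyContinuous _ _
  have hllr : llr (gibbs lam Y g) (empirical Y) =ᵐ[gibbs lam Y g] fun y =>
      -lam * pointPotential Y g y - Real.log (∑ t, 1 / (n : ℝ) * Real.exp (-lam * g t)) := by
    refine hac.ae_le ?_
    have := log_rnDeriv_tilted_left_self (integrable_empirical hn Y
      fun y => Real.exp (-lam * pointPotential Y g y))
    rw [integral_exp_pointPotential hG] at this
    exact this
  have iG := integrable_pointPotential hn Y g (gibbs lam Y g)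
  have hint : Integrable (llr (gibbs lam Y g) (empirical Y)) (gibbs lam Y g) :=
    ((iG.const_mul _).sub (integrable_const _)).congr hllr.symm
  have e : ∫ y, llr (gibbs lam Y g) (empirical Y) y ∂gibbs lam Y g
      = lam * (-∑ j, Real.exp (-lam * g j) / (∑ l, Real.exp (-lam * g l)) * g j
        - logMeanExp lam g) := by
    rw [integral_congr_ae hllr, integral_sub (iG.const_mul _) (integrable_const _),
      integral_const_mul, integral_gibbs hn hG]
    simp only [hG, logMeanExp, probReal_univ, integral_const, smul_eq_mul]
    field_simp
  have h0 := InformationTheory.integral_llr_add_sub_measure_univ_nonneg hac hint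
  rw [InformationTheory.klDiv_of_ac_of_integrable hac hint, ← ENNReal.ofReal_mul (by positivity)]
  rw [e] at h0 ⊢
  simp only [probReal_univ, add_sub_cancel_right] at h0 ⊢
  refine ⟨nonneg_of_mul_nonneg_right h0 hlam, ?_⟩
  congr 1
  field_simp

/-- Approximate strong duality. -/
theorem exists_rsw_le (hn : 1 ≤ n) (hlam : 0 < lam) {K ε : ℝ} (hε : 0 < ε)
    [IsProbabilityMeasure P] (hK : ∀ᵐ x ∂P, ∀ j, ‖x - Y j‖ ^ 2 ≤ K) :
    ∃ g : Fin n → ℝ, rsw lam (empirical Y) P ≠ ∞ ∧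
      (rsw lam (empirical Y) P).toReal ≤ ∫ x, h₁ lam Y x g ∂P + n * ε := by
  have hK0 : 0 ≤ K := by
    obtain ⟨x, hx⟩ := hK.exists
    exact (sq_nonneg _).trans (hx ⟨0, hn⟩)
  set c : Fin n → E m → ℝ := fun j x => ‖x - Y j‖ ^ 2 with hc
  have hcm : ∀ j, Measurable (c j) := fun j => by fun_prop
  have hcK : ∀ᵐ x ∂P, ∀ j, 0 ≤ c j x ∧ c j x ≤ K := by
    filter_upwards [hK] with x hx j
    exact ⟨sq_nonneg _, hx j⟩
  obtain ⟨g, hg⟩ := exists_integral_softAssign_eq (P := P) hn hlam hε hcm hcK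
  have hS : 0 < ∑ l, Real.exp (-lam * g l) := by
    have : Nonempty (Fin n) := ⟨⟨0, hn⟩⟩
    exact Finset.sum_pos (fun _ _ => Real.exp_pos _) Finset.univ_nonempty
  set p := softAssign ε c g with hp
  have hpm : ∀ j, Measurable (p j) := measurable_softAssign ε hcm g
  have hp0 : ∀ j x, 0 ≤ p j x := softAssign_nonneg hn ε c g
  have hp1 : ∀ j x, p j x ≤ 1 := softAssign_le_one hn ε c g
  have hpi : ∀ j, Integrable (p j) P := fun j =>
    Integrable.of_bound (hpm j).aestronglyMeasurable 1
      (ae_of_all _ fun x => by rw [Real.norm_of_nonneg (hp0 j x)]; exact hp1 j x)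
  have hpci : ∀ j, Integrable (fun x => p j x * c j x) P := fun j =>
    Integrable.of_bound ((hpm j).mul (hcm j)).aestronglyMeasurable K (by
      filter_upwards [hcK] with x hx
      rw [Real.norm_of_nonneg (mul_nonneg (hp0 j x) (hx j).1)]
      exact (mul_le_of_le_one_left (hx j).1 (hp1 j x)).trans (hx j).2)
  -- For equal data points the soft assignments differ by the factor `exp ((g j - g k) / ε)`, while
  -- stationarity forces the factor `exp (-lam * (g j - g k))`. Both hold only if `g j = g k`, so
  -- the potential is a genuine function of the data point.
  have hdup : ∀ j k, Y j = Y k → g j = g k := by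
    intro j k hjk
    have hck : c j = c k := by simp [hc, hjk]
    have e : ∀ x, p j x = Real.exp ((g j - g k) / ε) * p k x := by
      intro x
      simp only [hp, softAssign, hck]
      rw [← mul_div_assoc, ← Real.exp_add]
      ring_nf
    have h1 := hg j
    simp only [e, integral_const_mul, hg k] at h1
    have h2 : Real.exp ((g j - g k) / ε) * Real.exp (-lam * g k) = Real.exp (-lam * g j) := by
      rwa [← mul_div_assoc, div_left_inj' hS.ne'] at h1
    rw [← Real.exp_add] at h2
    have h3 := Real.exp_injective h2
    have h4 : (g j - g k) * (1 / ε + lam) = 0 := by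
      rw [mul_add, mul_one_div]
      linarith
    rcases mul_eq_zero.mp h4 with h | h
    · linarith
    · have : 0 < 1 / ε + lam := by positivity
      linarith
  have hG : ∀ j, pointPotential Y g (Y j) = g j := by
    intro j
    obtain ⟨k, hk, hk'⟩ := exists_pointPotential_eq Y g j
    rw [hk', hdup k j hk]
  have hQ := isProbabilityMeasure_gibbs hn lam Y g
  -- Stationarity is exactly the statement that the second marginal is the Gibbs measure.
  have hcoup : assignCoupling Y p P ∈ couplings P (gibbs lam Y g) := by
    refine ⟨map_fst_assignCoupling hpm hp0 (sum_softAssign hn ε c g), ?_⟩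
    ext s hs
    rw [map_snd_assignCoupling_apply hs hpi hp0, gibbs_apply hn hG hs]
    simp only [hg]
  have hle : rsw lam (empirical Y) P ≤
      ENNReal.ofReal (-∑ j, Real.exp (-lam * g j) / (∑ l, Real.exp (-lam * g l)) * g j
        - logMeanExp lam g) + ENNReal.ofReal (∑ j, ∫ x, p j x * c j x ∂P) := by
    refine (iInf₂_le (gibbs lam Y g) ⟨hQ, tilted_absolutelyContinuous _ _⟩).trans ?_
    rw [(klDiv_gibbs hn hlam hG).2, wasserstein_two_sq]
    exact add_le_add le_rfl ((iInf₂_le _ hcoup).trans (lintegral_assignCoupling hpm hp0 hpci).le)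
  have hpc0 : 0 ≤ ∑ j, ∫ x, p j x * c j x ∂P :=
    Finset.sum_nonneg fun j _ => integral_nonneg fun x => mul_nonneg (hp0 j x) (sq_nonneg _)
  rw [← ENNReal.ofReal_add (klDiv_gibbs hn hlam hG).1 hpc0] at hle
  refine ⟨g, ne_top_of_le_ne_top ENNReal.ofReal_ne_top hle, ?_⟩
  refine (ENNReal.toReal_le_of_le_ofReal (add_nonneg (klDiv_gibbs hn hlam hG).1 hpc0) hle).trans ?_
  have hmi : Integrable (fun x => minCost Y x g) P := by
    have : Nonempty (Fin n) := ⟨⟨0, hn⟩⟩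
    obtain ⟨k, hk⟩ := Finite.exists_max fun j => |g j|
    refine Integrable.of_bound (measurable_minCost_left Y g).aestronglyMeasurable (K + |g k|) ?_
    filter_upwards [hK] with x hx
    exact abs_minCost_le hn hx hk
  have h1 : ∑ j, ∫ x, p j x * (c j x - g j) ∂P ≤ ∫ x, minCost Y x g ∂P + n * ε := by
    have hij : ∀ j, Integrable (fun x => p j x * (c j x - g j)) P := fun j => by
      simp only [mul_sub]
      exact (hpci j).sub ((hpi j).mul_const _)
    rw [← integral_finsetSum _ fun j _ => hij j]
    have : ∫ x, minCost Y x g ∂P + n * ε = ∫ x, (minCost Y x g + n * ε) ∂P := by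
      rw [integral_add hmi (integrable_const _)]
      simp
    rw [this]
    refine integral_mono (integrable_finsetSum _ fun j _ => hij j)
      (hmi.add (integrable_const _)) fun x => ?_
    obtain ⟨k, hk⟩ := exists_minCost_eq hn Y x g
    simp only [hk]
    exact sum_softAssign_mul_le hn hε c g x k
  -- By stationarity the `g` terms of the transport part cancel those in the divergence, which
  -- leaves the soft minimum minus `logMeanExp`.
  have h2 : ∑ j, ∫ x, p j x * (c j x - g j) ∂P = ∑ j, ∫ x, p j x * c j x ∂P
      - ∑ j, Real.exp (-lam * g j) / (∑ l, Real.exp (-lam * g l)) * g j := by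
    rw [← Finset.sum_sub_distrib]
    refine Finset.sum_congr rfl fun j _ => ?_
    simp only [mul_sub]
    rw [integral_sub (hpci j) ((hpi j).mul_const _), integral_mul_const, hg]
  have h3 : ∫ x, h₁ lam Y x g ∂P = ∫ x, minCost Y x g ∂P - logMeanExp lam g := by
    simp only [h₁_eq]
    rw [integral_sub hmi (integrable_const _)]
    simp
  linarith

end StrongDuality

end RSW

namespace RSW

/-! ### Supergradients and the regret bound -/

section Regret

variable {m n : ℕ} {lam B : ℝ} {Y : Fin n → E m} {J : E m → (Fin n → ℝ) → Fin n}

theorem sum_softmax (hn : 1 ≤ n) (lam : ℝ) (g : Fin n → ℝ) :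
    ∑ j, Real.exp (-lam * g j) / (∑ l, Real.exp (-lam * g l)) = 1 := by
  have : Nonempty (Fin n) := ⟨⟨0, hn⟩⟩
  rw [← Finset.sum_div]
  exact div_self (Finset.sum_pos (fun _ _ => Real.exp_pos _) Finset.univ_nonempty).ne'

/-- This is the gradient inequality for the convex function `logMeanExp`, obtained from Jensen's
inequality for `exp` with the softmax weights of `g`. -/
theorem logMeanExp_sub_le (hn : 1 ≤ n) (hlam : 0 < lam) (g u : Fin n → ℝ) :
    logMeanExp lam g - logMeanExp lam u
      ≤ ∑ j, Real.exp (-lam * g j) / (∑ l, Real.exp (-lam * g l)) * (u j - g j) := by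
  have : Nonempty (Fin n) := ⟨⟨0, hn⟩⟩
  have hn' : (0 : ℝ) < n := by exact_mod_cast hn
  have hS : ∀ v : Fin n → ℝ, 0 < ∑ l, Real.exp (-lam * v l) := fun v =>
    Finset.sum_pos (fun _ _ => Real.exp_pos _) Finset.univ_nonempty
  have key := convexOn_exp.map_sum_le (t := Finset.univ)
    (w := fun j => Real.exp (-lam * g j) / (∑ l, Real.exp (-lam * g l)))
    (p := fun j => -lam * (u j - g j))
    (fun j _ => div_nonneg (Real.exp_pos _).le (hS g).le) (sum_softmax hn lam g)
    (fun _ _ => Set.mem_univ _)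
  have e1 : ∑ j, (Real.exp (-lam * g j) / (∑ l, Real.exp (-lam * g l))) •
      Real.exp (-lam * (u j - g j))
      = (∑ l, Real.exp (-lam * u l)) / ∑ l, Real.exp (-lam * g l) := by
    rw [Finset.sum_div]
    refine Finset.sum_congr rfl fun j _ => ?_
    rw [smul_eq_mul, div_mul_eq_mul_div, ← Real.exp_add]
    ring_nf
  have e2 : ∑ j, (Real.exp (-lam * g j) / (∑ l, Real.exp (-lam * g l))) •
      (-lam * (u j - g j)) = -lam *
        ∑ j, Real.exp (-lam * g j) / (∑ l, Real.exp (-lam * g l)) * (u j - g j) := by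
    rw [Finset.mul_sum]
    refine Finset.sum_congr rfl fun j _ => ?_
    rw [smul_eq_mul]
    ring
  rw [e1, e2] at key
  have h := Real.log_le_log (Real.exp_pos _) key
  rw [Real.log_exp, Real.log_div (hS u).ne' (hS g).ne'] at h
  have e3 : ∀ v : Fin n → ℝ, logMeanExp lam v
      = 1 / lam * (Real.log (∑ l, Real.exp (-lam * v l)) - Real.log n) := by
    intro v
    rw [logMeanExp, ← Finset.mul_sum, Real.log_mul (by positivity) (hS v).ne', one_div (n : ℝ),
      Real.log_inv]
    ring
  rw [e3, e3, ← mul_sub, one_div_mul_eq_div, div_le_iff₀ hlam]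
  linarith

/-- The supergradient of `h₁ x` at `g` used by the ascent. -/
noncomputable def supergradient (lam : ℝ) (J : E m → (Fin n → ℝ) → Fin n) (x : E m)
    (g : Fin n → ℝ) (j : Fin n) : ℝ :=
  Real.exp (-lam * g j) / (∑ l, Real.exp (-lam * g l)) - if j = J x g then 1 else 0

theorem iterate_succ (lam B : ℝ) (Y : Fin n → E m) (J : E m → (Fin n → ℝ) → Fin n)
    (g₀ : Fin n → ℝ) (X : ℕ → E m) (i : ℕ) (j : Fin n) :
    iterate lam B Y J g₀ X (i + 1) j = iterate lam B Y J g₀ X i j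
      + learningRate n B (i + 1) * supergradient lam J (X i) (iterate lam B Y J g₀ X i) j := rfl

/-- The minimizer for `g` is a competitor in the minimum for `u`; convexity of `logMeanExp` handles
the other term. -/
theorem h₁_sub_le (hlam : 0 < lam) (hJ : IsArgminRule Y J) (x : E m) (g u : Fin n → ℝ) :
    h₁ lam Y x u - h₁ lam Y x g ≤ ∑ j, supergradient lam J x g j * (u j - g j) := by
  have hn : 1 ≤ n := (J x g).pos
  have h1 := logMeanExp_sub_le hn hlam g u
  have h2 := minCost_le Y x u (J x g)
  have h3 : minCost Y x g = ‖x - Y (J x g)‖ ^ 2 - g (J x g) := iInf_shiftedCost hJ x g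
  simp only [supergradient, sub_mul, Finset.sum_sub_distrib, ite_mul, one_mul, zero_mul,
    Finset.sum_ite_eq', Finset.mem_univ, if_true, h₁_eq] at h1 ⊢
  linarith

theorem softmax_mem_Icc (hn : 1 ≤ n) (lam : ℝ) (g : Fin n → ℝ) (j : Fin n) :
    Real.exp (-lam * g j) / (∑ l, Real.exp (-lam * g l)) ∈ Set.Icc (0 : ℝ) 1 := by
  refine ⟨by positivity, ?_⟩
  rw [← sum_softmax hn lam g]
  exact Finset.single_le_sum (f := fun j => Real.exp (-lam * g j) / (∑ l, Real.exp (-lam * g l)))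
    (fun _ _ => by positivity) (Finset.mem_univ j)

theorem abs_supergradient_le (hn : 1 ≤ n) (lam : ℝ) (J : E m → (Fin n → ℝ) → Fin n) (x : E m)
    (g : Fin n → ℝ) (j : Fin n) : |supergradient lam J x g j| ≤ 1 := by
  obtain ⟨h1, h2⟩ := softmax_mem_Icc hn lam g j
  unfold supergradient
  rw [abs_le]
  split_ifs <;> constructor <;> linarith

/-- The supergradient is a difference of two probability vectors; with entries in `[0, 1]`, the
square of each difference is at most the sum of the two entries. -/
theorem sum_supergradient_sq_le (hn : 1 ≤ n) (lam : ℝ) (J : E m → (Fin n → ℝ) → Fin n) (x : E m)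
    (g : Fin n → ℝ) : ∑ j, supergradient lam J x g j ^ 2 ≤ 2 := by
  calc ∑ j, supergradient lam J x g j ^ 2
      ≤ ∑ j, (Real.exp (-lam * g j) / (∑ l, Real.exp (-lam * g l))
          + if j = J x g then 1 else 0) := by
        refine Finset.sum_le_sum fun j _ => ?_
        obtain ⟨h1, h2⟩ := softmax_mem_Icc hn lam g j
        unfold supergradient
        split_ifs <;> nlinarith
    _ = 2 := by
        rw [Finset.sum_add_distrib, sum_softmax hn]
        simp
        norm_num

theorem learningRate_pos (hn : 1 ≤ n) (hB : 0 < B) (i : ℕ) : 0 < learningRate n B (i + 1) := by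
  have hn' : (0 : ℝ) < n := by exact_mod_cast hn
  unfold learningRate
  positivity

/-- The regret bound of subgradient ascent against a fixed potential `u`. -/
theorem regret_le (hlam : 0 < lam) (hB : 0 < B) (hJ : IsArgminRule Y J) (hn : 1 ≤ n)
    (X : ℕ → E m) (u : Fin n → ℝ) (s : ℕ) :
    ∑ i ∈ Finset.range s, learningRate n B (i + 1) *
        (h₁ lam Y (X i) u - h₁ lam Y (X i) (iterate lam B Y J 0 X i))
      ≤ (∑ j, u j ^ 2) / 2 + ∑ i ∈ Finset.range s, learningRate n B (i + 1) ^ 2 := by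
  -- Keeping the squared distance to `u` makes the induction telescope: expanding the square of one
  -- step produces the supergradient inequality and an error `γ ^ 2 * 2 / 2`.
  suffices h : ∑ i ∈ Finset.range s, learningRate n B (i + 1) *
        (h₁ lam Y (X i) u - h₁ lam Y (X i) (iterate lam B Y J 0 X i))
      ≤ (∑ j, u j ^ 2) / 2 - (∑ j, (iterate lam B Y J 0 X s j - u j) ^ 2) / 2
        + ∑ i ∈ Finset.range s, learningRate n B (i + 1) ^ 2 by
    have : 0 ≤ ∑ j, (iterate lam B Y J 0 X s j - u j) ^ 2 :=
      Finset.sum_nonneg fun _ _ => sq_nonneg _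
    linarith
  induction s with
  | zero => simp [iterate]
  | succ s ih =>
    rw [Finset.sum_range_succ, Finset.sum_range_succ]
    set g := iterate lam B Y J 0 X s with hg
    set γ := learningRate n B (s + 1) with hγ
    have hγ0 : 0 < γ := learningRate_pos hn hB s
    have h1 := h₁_sub_le hlam hJ (X s) g u
    have h2 := sum_supergradient_sq_le hn lam J (X s) g
    have e : ∑ j, (iterate lam B Y J 0 X (s + 1) j - u j) ^ 2
        = ∑ j, (g j - u j) ^ 2 - 2 * γ * ∑ j, supergradient lam J (X s) g j * (u j - g j)
          + γ ^ 2 * ∑ j, supergradient lam J (X s) g j ^ 2 := by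
      rw [Finset.mul_sum, Finset.mul_sum, ← Finset.sum_sub_distrib, ← Finset.sum_add_distrib]
      refine Finset.sum_congr rfl fun j _ => ?_
      rw [iterate_succ]
      ring
    rw [e]
    have h3 := mul_le_mul_of_nonneg_left h1 hγ0.le
    have h4 := mul_le_mul_of_nonneg_left h2 (sq_nonneg γ)
    linarith

/-- A crude bound, needed only for integrability. -/
theorem abs_iterate_le (hn : 1 ≤ n) (hB : 0 < B) (lam : ℝ) (Y : Fin n → E m)
    (J : E m → (Fin n → ℝ) → Fin n) (X : ℕ → E m) (s : ℕ) (j : Fin n) :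
    |iterate lam B Y J 0 X s j| ≤ ∑ i ∈ Finset.range s, learningRate n B (i + 1) := by
  induction s with
  | zero => simp [iterate]
  | succ s ih =>
    rw [iterate_succ, Finset.sum_range_succ]
    refine (abs_add_le _ _).trans (add_le_add ih ?_)
    rw [abs_mul, abs_of_pos (learningRate_pos hn hB s)]
    exact mul_le_of_le_one_right (learningRate_pos hn hB s).le (abs_supergradient_le hn _ _ _ _ _)

theorem sum_learningRate_sq_le (n : ℕ) (B : ℝ) (s : ℕ) :
    ∑ i ∈ Finset.range s, learningRate n B (i + 1) ^ 2 ≤ B ^ 2 * n * (1 + Real.log s) := by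
  have h := harmonic_le_one_add_log s
  have : ∑ i ∈ Finset.range s, learningRate n B (i + 1) ^ 2 = B ^ 2 * n * (harmonic s : ℝ) := by
    rw [harmonic]
    push_cast
    rw [Finset.mul_sum]
    refine Finset.sum_congr rfl fun i _ => ?_
    rw [learningRate, mul_pow, Real.sq_sqrt (by positivity)]
    push_cast
    ring
  rw [this]
  gcongr

/-- The rates decrease, so each of the `s` terms is at least the last one. -/
theorem le_sum_learningRate (hB : 0 < B) {s : ℕ} (hs : 1 ≤ s) :
    B * √(n * s) ≤ ∑ i ∈ Finset.range s, learningRate n B (i + 1) := by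
  have hs' : (0 : ℝ) < s := by exact_mod_cast hs
  have h : ∀ i ∈ Finset.range s, B * √(n / s) ≤ learningRate n B (i + 1) := by
    intro i hi
    unfold learningRate
    have : ((i + 1 : ℕ) : ℝ) ≤ s := by exact_mod_cast Finset.mem_range.mp hi
    gcongr
  have h2 := Finset.card_nsmul_le_sum _ _ _ h
  rw [Finset.card_range, nsmul_eq_mul] at h2
  refine le_trans (le_of_eq ?_) h2
  have : (n : ℝ) * s = s ^ 2 * (n / s) := by field_simp
  rw [this, Real.sqrt_mul (by positivity), Real.sqrt_sq hs'.le]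
  ring

end Regret

end RSW

namespace RSW

/-! ### Independence of a sample from its past -/

section Independence

/-- A function of two independent variables that has mean zero in the second variable has mean
zero. -/
theorem integral_eq_zero_of_indepFun {Ω 𝒰 𝒱 : Type*} [MeasurableSpace Ω] [MeasurableSpace 𝒰]
    [MeasurableSpace 𝒱] {μ : Measure Ω} [IsProbabilityMeasure μ] {U : Ω → 𝒰} {V : Ω → 𝒱}
    (hU : Measurable U) (hV : Measurable V) (hUV : IndepFun U V μ) {φ : 𝒰 × 𝒱 → ℝ}
    (hφ : Measurable φ) (hi : Integrable (fun ω => φ (U ω, V ω)) μ)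
    (h0 : ∀ u, ∫ v, φ (u, v) ∂μ.map V = 0) : ∫ ω, φ (U ω, V ω) ∂μ = 0 := by
  have : IsProbabilityMeasure (μ.map U) := Measure.isProbabilityMeasure_map hU.aemeasurable
  have : IsProbabilityMeasure (μ.map V) := Measure.isProbabilityMeasure_map hV.aemeasurable
  have hmap := (indepFun_iff_map_prod_eq_prod_map_map hU.aemeasurable hV.aemeasurable).mp hUV
  have hm : Measurable fun ω => (U ω, V ω) := hU.prodMk hV
  have e : ∫ ω, φ (U ω, V ω) ∂μ = ∫ z, φ z ∂μ.map fun ω => (U ω, V ω) :=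
    (integral_map hm.aemeasurable hφ.aestronglyMeasurable).symm
  have hi' : Integrable φ ((μ.map U).prod (μ.map V)) := by
    rw [← hmap]
    exact (integrable_map_measure hφ.aestronglyMeasurable hm.aemeasurable).mpr hi
  rw [e, hmap, integral_prod _ hi']
  simp [h0]

/-- The first `i` terms of a sequence of random variables, continued by `0`. -/
noncomputable def past {Ω : Type*} {m : ℕ} (X : ℕ → Ω → E m) (i : ℕ) (ω : Ω) (k : ℕ) : E m :=
  if k < i then X k ω else 0

variable {Ω : Type*} [MeasurableSpace Ω] {μ : Measure Ω} {m s : ℕ} {X : ℕ → Ω → E m}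

theorem measurable_past (hX : ∀ i < s, Measurable (X i)) {i : ℕ} (hi : i ≤ s) :
    Measurable (past X i) := by
  refine measurable_pi_lambda _ fun k => ?_
  unfold past
  split_ifs with h
  · exact hX k (by omega)
  · exact measurable_const

theorem indepFun_past (hX : ∀ i < s, Measurable (X i))
    (hind : iIndepFun (fun i : Fin s => X i) μ) {i : ℕ} (hi : i < s) :
    IndepFun (past X i) (X i) μ := by
  set S : Finset (Fin s) := Finset.univ.filter fun k => k.1 < i
  have h := hind.indepFun_finset S {⟨i, hi⟩} (by simp [S]) fun k => hX k k.2
  -- `ψ` rebuilds the zero-padded sequence from the finite subfamily of samples before `i`, which is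
  -- independent of sample `i`.
  let ψ : (S → E m) → ℕ → E m := fun v k =>
    if h : ∃ h : k < s, (⟨k, h⟩ : Fin s) ∈ S then v ⟨⟨k, h.1⟩, h.2⟩ else 0
  have hψ : Measurable ψ := by
    refine measurable_pi_lambda _ fun k => ?_
    by_cases h : ∃ h : k < s, (⟨k, h⟩ : Fin s) ∈ S
    · simp only [ψ, h, dif_pos]
      exact measurable_pi_apply _
    · simp only [ψ, h, dif_neg, not_false_eq_true]
      exact measurable_const
  have h2 := h.comp hψ (measurable_pi_apply (⟨⟨i, hi⟩, by simp⟩ : ({⟨i, hi⟩} : Finset (Fin s))))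
  convert h2 using 1
  · funext ω k
    simp only [past, Function.comp, ψ, S, Finset.mem_filter, Finset.mem_univ, true_and]
    by_cases hk : k < i
    · rw [if_pos hk, dif_pos ⟨by omega, hk⟩]
    · rw [if_neg hk, dif_neg (by rintro ⟨-, h⟩; exact hk h)]
  · rfl

end Independence

/-! ### Measurability of the iterates -/

section Iterates

variable {m n : ℕ} {lam B : ℝ} {Y : Fin n → E m} {J : E m → (Fin n → ℝ) → Fin n}

theorem iterate_congr {g₀ : Fin n → ℝ} {X X' : ℕ → E m} {i : ℕ} (h : ∀ k < i, X k = X' k) :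
    iterate lam B Y J g₀ X i = iterate lam B Y J g₀ X' i := by
  induction i with
  | zero => rfl
  | succ i ih =>
    funext j
    rw [iterate_succ, iterate_succ, ih fun k hk => h k (by omega), h i (by omega)]

theorem measurable_supergradient (lam : ℝ) (hJ : IsArgminRule Y J) (j : Fin n) :
    Measurable fun p : E m × (Fin n → ℝ) => supergradient lam J p.1 p.2 j := by
  unfold supergradient
  refine Measurable.sub (by fun_prop) (Measurable.ite ?_ measurable_const measurable_const)
  have := hJ.measurable (measurableSet_singleton j)
  convert this using 1
  ext p
  simp [Function.uncurry, eq_comm]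

theorem measurable_iterate (hJ : IsArgminRule Y J) (i : ℕ) :
    Measurable fun X : ℕ → E m => iterate lam B Y J 0 X i := by
  induction i with
  | zero => exact measurable_const
  | succ i ih =>
    refine measurable_pi_lambda _ fun j => ?_
    simp only [iterate_succ]
    have h1 : Measurable fun X : ℕ → E m => (X i, iterate lam B Y J 0 X i) :=
      (measurable_pi_apply i).prodMk ih
    exact ((measurable_pi_apply j).comp ih).add
      (((measurable_supergradient lam hJ j).comp h1).const_mul _)

/-- An iterate sees only earlier samples, so it is a function of `past`. -/
theorem iterate_past {Ω : Type*} (X : ℕ → Ω → E m) {i k : ℕ} (hik : i ≤ k) (ω : Ω) :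
    iterate lam B Y J 0 (past X k ω) i = iterate lam B Y J 0 (fun l => X l ω) i :=
  iterate_congr fun l hl => by simp [past, show l < k by omega]

end Iterates

/-! ### Martingale bounds for the deviations -/

section Martingale

variable {m n : ℕ} {lam B K : ℝ} {Y : Fin n → E m} {J : E m → (Fin n → ℝ) → Fin n}
  {P : Measure (E m)}

/-- The deviation of the `c`-transform from its mean. -/
noncomputable def deviation (Y : Fin n → E m) (P : Measure (E m)) (x : E m) (g : Fin n → ℝ) : ℝ :=
  minCost Y x g - ∫ y, minCost Y y g ∂P

theorem measurable_deviation [SFinite P] (Y : Fin n → E m) :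
    Measurable fun p : E m × (Fin n → ℝ) => deviation Y P p.1 p.2 := by
  have h : StronglyMeasurable fun p : (Fin n → ℝ) × E m => minCost Y p.2 p.1 :=
    ((measurable_minCost Y).comp measurable_swap).stronglyMeasurable
  have h2 : Measurable fun g => ∫ y, minCost Y y g ∂P :=
    (StronglyMeasurable.integral_prod_right' (ν := P) h).measurable
  exact (measurable_minCost Y).sub (h2.comp measurable_snd)

theorem integrable_minCost (hn : 1 ≤ n) [IsFiniteMeasure P]
    (hK : ∀ᵐ x ∂P, ∀ j, ‖x - Y j‖ ^ 2 ≤ K) (g : Fin n → ℝ) :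
    Integrable (fun x => minCost Y x g) P := by
  have : Nonempty (Fin n) := ⟨⟨0, hn⟩⟩
  obtain ⟨k, hk⟩ := Finite.exists_max fun j => |g j|
  refine Integrable.of_bound (measurable_minCost_left Y g).aestronglyMeasurable (K + |g k|) ?_
  filter_upwards [hK] with x hx
  exact abs_minCost_le hn hx hk

theorem integral_deviation (hn : 1 ≤ n) [IsProbabilityMeasure P]
    (hK : ∀ᵐ x ∂P, ∀ j, ‖x - Y j‖ ^ 2 ≤ K) (g : Fin n → ℝ) :
    ∫ x, deviation Y P x g ∂P = 0 := by
  unfold deviation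
  rw [integral_sub (integrable_minCost hn hK g) (integrable_const _)]
  simp

/-- The minimizer for `y` is a competitor for `x`, and its entry of `g` cancels. The oscillation
bound `K` therefore does not depend on `g`, although the iterates have no uniform bound in `s`. -/
theorem minCost_sub_le (hn : 1 ≤ n) {x y : E m} (hx : ∀ j, ‖x - Y j‖ ^ 2 ≤ K) (g : Fin n → ℝ) :
    minCost Y x g - K ≤ minCost Y y g := by
  obtain ⟨j, hj⟩ := exists_minCost_eq hn Y y g
  have := minCost_le Y x g j
  rw [hj]
  linarith [hx j, sq_nonneg ‖y - Y j‖]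

theorem abs_deviation_le (hn : 1 ≤ n) [IsProbabilityMeasure P]
    (hK : ∀ᵐ x ∂P, ∀ j, ‖x - Y j‖ ^ 2 ≤ K) {x : E m} (hx : ∀ j, ‖x - Y j‖ ^ 2 ≤ K)
    (g : Fin n → ℝ) : |deviation Y P x g| ≤ K := by
  have hi := integrable_minCost hn hK g
  have h1 : minCost Y x g - K ≤ ∫ y, minCost Y y g ∂P := by
    have := integral_mono_ae (integrable_const (minCost Y x g - K)) hi
      (ae_of_all _ fun y => minCost_sub_le hn hx g)
    simpa using this
  have h2 : ∫ y, minCost Y y g ∂P ≤ minCost Y x g + K := by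
    have := integral_mono_ae hi (integrable_const (minCost Y x g + K)) (by
      filter_upwards [hK] with y hy
      linarith [minCost_sub_le hn (y := x) hy g])
    simpa using this
  unfold deviation
  rw [abs_le]
  constructor <;> linarith

/-- The weighted sum of the first `i` deviations along the ascent. -/
noncomputable def deviationSum (lam B : ℝ) (Y : Fin n → E m) (J : E m → (Fin n → ℝ) → Fin n)
    (P : Measure (E m)) (i : ℕ) (X : ℕ → E m) : ℝ :=
  ∑ k ∈ Finset.range i, learningRate n B (k + 1) * deviation Y P (X k) (iterate lam B Y J 0 X k)

theorem deviationSum_past {Ω : Type*} (X : ℕ → Ω → E m) {i k : ℕ} (hik : i ≤ k) (ω : Ω) :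
    deviationSum lam B Y J P i (past X k ω) = deviationSum lam B Y J P i fun l => X l ω := by
  unfold deviationSum
  refine Finset.sum_congr rfl fun l hl => ?_
  have hl := Finset.mem_range.mp hl
  rw [iterate_past X (by omega)]
  simp [past, show l < k by omega]

variable {Ω : Type*} [MeasurableSpace Ω] {μ : Measure Ω} {s : ℕ} {X : ℕ → Ω → E m}

theorem measurable_deviationSum [SFinite P] (hJ : IsArgminRule Y J) (i : ℕ) :
    Measurable (deviationSum lam B Y J P i) := by
  unfold deviationSum
  refine Finset.measurable_sum _ fun k _ => Measurable.const_mul ?_ _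
  have h1 : Measurable fun X : ℕ → E m => (X k, iterate lam B Y J 0 X k) :=
    (measurable_pi_apply k).prodMk (measurable_iterate hJ k)
  have h2 := (measurable_deviation (P := P) Y).comp h1
  exact h2

theorem abs_deviationSum_le (hn : 1 ≤ n) (hB : 0 < B) [IsProbabilityMeasure P]
    (hK : ∀ᵐ x ∂P, ∀ j, ‖x - Y j‖ ^ 2 ≤ K) {x : ℕ → E m} {i : ℕ}
    (hx : ∀ k < i, ∀ j, ‖x k - Y j‖ ^ 2 ≤ K) :
    |deviationSum lam B Y J P i x| ≤ ∑ k ∈ Finset.range i, learningRate n B (k + 1) * K := by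
  refine (Finset.abs_sum_le_sum_abs _ _).trans (Finset.sum_le_sum fun k hk => ?_)
  rw [abs_mul, abs_of_pos (learningRate_pos hn hB k)]
  exact mul_le_mul_of_nonneg_left (abs_deviation_le hn hK (hx k (Finset.mem_range.mp hk)) _)
    (learningRate_pos hn hB k).le

theorem ae_forall_sample (hX : ∀ i < s, Measurable (X i)) (hP : ∀ i < s, μ.map (X i) = P)
    {p : E m → Prop} (hp : ∀ᵐ x ∂P, p x) : ∀ᵐ ω ∂μ, ∀ i < s, p (X i ω) := by
  rw [ae_all_iff]
  intro i
  rw [ae_all_iff]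
  intro hi
  rw [← hP i hi] at hp
  exact ae_of_ae_map (hX i hi).aemeasurable hp

variable [IsProbabilityMeasure μ] [IsProbabilityMeasure P]

theorem integrable_of_past (hX : ∀ i < s, Measurable (X i)) {i : ℕ} (hi : i < s) {R : ℝ}
    {φ : (ℕ → E m) × E m → ℝ} (hφ : Measurable φ)
    (hR : ∀ᵐ ω ∂μ, |φ (past X i ω, X i ω)| ≤ R) :
    Integrable (fun ω => φ (past X i ω, X i ω)) μ :=
  Integrable.of_bound (hφ.comp ((measurable_past hX hi.le).prodMk
    (hX i hi))).aestronglyMeasurable R hR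

theorem measurable_deviation_past (hJ : IsArgminRule Y J) (i : ℕ) :
    Measurable fun z : (ℕ → E m) × E m => deviation Y P z.2 (iterate lam B Y J 0 z.1 i) := by
  have h1 : Measurable fun z : (ℕ → E m) × E m => (z.2, iterate lam B Y J 0 z.1 i) :=
    measurable_snd.prodMk ((measurable_iterate hJ i).comp measurable_fst)
  have h2 := (measurable_deviation (P := P) Y).comp h1
  exact h2

/-- With the past frozen the iterate is constant and the fresh sample has law `P`, so the deviation
has mean zero. The bound `R` only secures integrability. -/
theorem integral_mul_deviation (hn : 1 ≤ n) (hJ : IsArgminRule Y J)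
    (hK : ∀ᵐ x ∂P, ∀ j, ‖x - Y j‖ ^ 2 ≤ K) (hX : ∀ i < s, Measurable (X i))
    (hP : ∀ i < s, μ.map (X i) = P) (hind : iIndepFun (fun i : Fin s => X i) μ) {i : ℕ}
    (hi : i < s) {ψ : (ℕ → E m) → ℝ} (hψ : Measurable ψ) {R : ℝ}
    (hR : ∀ᵐ ω ∂μ, |ψ (past X i ω)| ≤ R) :
    Integrable (fun ω => ψ (past X i ω) *
      deviation Y P (X i ω) (iterate lam B Y J 0 (fun l => X l ω) i)) μ ∧
    ∫ ω, ψ (past X i ω) * deviation Y P (X i ω) (iterate lam B Y J 0 (fun l => X l ω) i) ∂μ = 0 := by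
  set φ : (ℕ → E m) × E m → ℝ := fun z =>
    ψ z.1 * deviation Y P z.2 (iterate lam B Y J 0 z.1 i) with hφdef
  have hφ : Measurable φ := (hψ.comp measurable_fst).mul (measurable_deviation_past hJ i)
  have hint : Integrable (fun ω => φ (past X i ω, X i ω)) μ := by
    refine integrable_of_past hX hi (R := R * K) hφ ?_
    filter_upwards [hR, ae_forall_sample hX hP hK] with ω h1 h2
    rw [hφdef, abs_mul]
    exact mul_le_mul h1 (abs_deviation_le hn hK (h2 i hi) _) (abs_nonneg _)
      ((abs_nonneg _).trans h1)
  have h0 := integral_eq_zero_of_indepFun (measurable_past hX hi.le) (hX i hi)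
    (indepFun_past hX hind hi) hφ hint fun u => by
      rw [hP i hi]
      simp only [hφdef]
      rw [integral_const_mul, integral_deviation hn hK, mul_zero]
  simp only [hφdef, iterate_past X le_rfl] at hint h0
  exact ⟨hint, h0⟩

theorem integral_deviationSum (hn : 1 ≤ n) (hJ : IsArgminRule Y J)
    (hK : ∀ᵐ x ∂P, ∀ j, ‖x - Y j‖ ^ 2 ≤ K) (hX : ∀ i < s, Measurable (X i))
    (hP : ∀ i < s, μ.map (X i) = P) (hind : iIndepFun (fun i : Fin s => X i) μ) :
    ∫ ω, deviationSum lam B Y J P s (fun l => X l ω) ∂μ = 0 := by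
  have h : ∀ i ∈ Finset.range s, Integrable (fun ω =>
      learningRate n B (i + 1) * deviation Y P (X i ω) (iterate lam B Y J 0 (fun l => X l ω) i)) μ ∧
      ∫ ω, learningRate n B (i + 1) *
        deviation Y P (X i ω) (iterate lam B Y J 0 (fun l => X l ω) i) ∂μ = 0 := fun i hi =>
    integral_mul_deviation hn hJ hK hX hP hind (Finset.mem_range.mp hi) measurable_const
      (ae_of_all _ fun _ => le_rfl)
  unfold deviationSum
  rw [integral_finsetSum _ fun i hi => (h i hi).1]
  exact Finset.sum_eq_zero fun i hi => (h i hi).2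

theorem memLp_deviationSum (hn : 1 ≤ n) (hB : 0 < B) (hJ : IsArgminRule Y J)
    (hK : ∀ᵐ x ∂P, ∀ j, ‖x - Y j‖ ^ 2 ≤ K) (hX : ∀ i < s, Measurable (X i))
    (hP : ∀ i < s, μ.map (X i) = P) {i : ℕ} (hi : i ≤ s) (p : ℝ≥0∞) :
    MemLp (fun ω => deviationSum lam B Y J P i fun l => X l ω) p μ := by
  refine MemLp.of_bound ?_ (∑ k ∈ Finset.range i, learningRate n B (k + 1) * K) ?_
  · simp only [← deviationSum_past X (le_refl i)]
    exact ((measurable_deviationSum hJ i).comp (measurable_past hX hi)).aestronglyMeasurable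
  · filter_upwards [ae_forall_sample hX hP hK] with ω h
    exact abs_deviationSum_le hn hB hK fun k hk => h k (by omega)

/-- Martingale increments are orthogonal: the cross term vanishes, and each new square contributes
at most `K ^ 2` times the squared rate. -/
theorem integral_deviationSum_sq_le (hn : 1 ≤ n) (hB : 0 < B) (hJ : IsArgminRule Y J)
    (hK : ∀ᵐ x ∂P, ∀ j, ‖x - Y j‖ ^ 2 ≤ K) (hX : ∀ i < s, Measurable (X i))
    (hP : ∀ i < s, μ.map (X i) = P) (hind : iIndepFun (fun i : Fin s => X i) μ) {i : ℕ}
    (hi : i ≤ s) :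
    ∫ ω, (deviationSum lam B Y J P i fun l => X l ω) ^ 2 ∂μ
      ≤ K ^ 2 * ∑ k ∈ Finset.range i, learningRate n B (k + 1) ^ 2 := by
  induction i with
  | zero => simp [deviationSum]
  | succ i ih =>
    have hi' : i < s := hi
    set γ := learningRate n B (i + 1) with hγ
    set S : Ω → ℝ := fun ω => deviationSum lam B Y J P i fun l => X l ω with hS
    set d : Ω → ℝ := fun ω =>
      deviation Y P (X i ω) (iterate lam B Y J 0 (fun l => X l ω) i) with hd
    have hae := ae_forall_sample hX hP hK
    obtain ⟨hc1, hc2⟩ := integral_mul_deviation (lam := lam) (B := B) hn hJ hK hX hP hind hi'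
      (measurable_deviationSum (lam := lam) (B := B) (P := P) hJ i)
      (R := ∑ k ∈ Finset.range i, learningRate n B (k + 1) * K) (by
        filter_upwards [hae] with ω h
        rw [deviationSum_past X le_rfl]
        exact abs_deviationSum_le hn hB hK fun k hk => h k (by omega))
    simp only [deviationSum_past X (le_refl i)] at hc1 hc2
    have hS2 : Integrable (fun ω => S ω ^ 2) μ :=
      (memLp_deviationSum hn hB hJ hK hX hP hi'.le 2).integrable_sq
    have hdK : ∀ᵐ ω ∂μ, |d ω| ≤ K := by
      filter_upwards [hae] with ω h
      exact abs_deviation_le hn hK (h i hi') _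
    have hdm : AEStronglyMeasurable d μ := by
      have := (measurable_deviation_past (lam := lam) (B := B) (P := P) hJ i).comp
        ((measurable_past hX hi'.le).prodMk (hX i hi'))
      simp only [Function.comp_def, iterate_past X (le_refl i)] at this
      exact this.aestronglyMeasurable
    have hd2 : Integrable (fun ω => d ω ^ 2) μ := (MemLp.of_bound hdm K hdK).integrable_sq
    have hd2K : ∫ ω, d ω ^ 2 ∂μ ≤ K ^ 2 := by
      have := integral_mono_ae hd2 (integrable_const (K ^ 2)) (by
        filter_upwards [hdK] with ω h
        exact sq_le_sq' (abs_le.mp h).1 (abs_le.mp h).2)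
      simpa using this
    have e : ∀ ω, (deviationSum lam B Y J P (i + 1) fun l => X l ω) ^ 2
        = S ω ^ 2 + 2 * γ * (S ω * d ω) + γ ^ 2 * d ω ^ 2 := by
      intro ω
      rw [deviationSum, Finset.sum_range_succ]
      simp only [hS, hd, hγ, deviationSum]
      ring
    simp only [e]
    have a1 : Integrable (fun ω => 2 * γ * (S ω * d ω)) μ := hc1.const_mul _
    have a2 : Integrable (fun ω => γ ^ 2 * d ω ^ 2) μ := hd2.const_mul _
    have a3 : Integrable (fun ω => S ω ^ 2 + 2 * γ * (S ω * d ω)) μ := hS2.add a1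
    have a4 : ∫ ω, S ω * d ω ∂μ = 0 := hc2
    rw [integral_add a3 a2, integral_add hS2 a1, integral_const_mul, integral_const_mul, a4,
      Finset.sum_range_succ]
    have := ih hi'.le
    nlinarith [mul_le_mul_of_nonneg_left hd2K (sq_nonneg γ)]

theorem integral_abs_deviationSum_le (hn : 1 ≤ n) (hB : 0 < B) (hK0 : 0 ≤ K)
    (hJ : IsArgminRule Y J)
    (hK : ∀ᵐ x ∂P, ∀ j, ‖x - Y j‖ ^ 2 ≤ K) (hX : ∀ i < s, Measurable (X i))
    (hP : ∀ i < s, μ.map (X i) = P) (hind : iIndepFun (fun i : Fin s => X i) μ) :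
    ∫ ω, |deviationSum lam B Y J P s fun l => X l ω| ∂μ
      ≤ K * √(∑ k ∈ Finset.range s, learningRate n B (k + 1) ^ 2) := by
  have h1 := memLp_deviationSum (lam := lam) hn hB hJ hK hX hP le_rfl 2
  have h1' : MemLp (fun ω => |deviationSum lam B Y J P s fun l => X l ω|) 2 μ := h1.abs
  -- Nonnegative variance of the absolute value bounds the first absolute moment by the root of the
  -- second moment.
  have h2 := variance_nonneg (fun ω => |deviationSum lam B Y J P s fun l => X l ω|) μ
  rw [variance_eq_sub h1'] at h2
  have h3 := integral_deviationSum_sq_le (lam := lam) hn hB hJ hK hX hP hind le_rfl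
  have h4 : ∫ ω, |deviationSum lam B Y J P s fun l => X l ω| ∂μ
      ≤ √(K ^ 2 * ∑ k ∈ Finset.range s, learningRate n B (k + 1) ^ 2) := by
    refine Real.le_sqrt_of_sq_le (le_trans ?_ h3)
    simp only [Pi.pow_apply, sq_abs] at h2
    linarith
  rwa [Real.sqrt_mul (sq_nonneg K), Real.sqrt_sq hK0] at h4

end Martingale

end RSW

namespace RSW

/-! ### Expected error of the estimate -/

section Accuracy

variable {m n : ℕ} {lam B K : ℝ} {Y : Fin n → E m} {J : E m → (Fin n → ℝ) → Fin n}
  {P : Measure (E m)}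

variable {Ω : Type*} [MeasurableSpace Ω] {μ : Measure Ω} [IsProbabilityMeasure μ] {s : ℕ}
  {X : ℕ → Ω → E m}

theorem integrable_h₁_iterate (hn : 1 ≤ n) (hlam : 0 < lam) (hB : 0 < B) (hJ : IsArgminRule Y J)
    (hK : ∀ᵐ x ∂P, ∀ j, ‖x - Y j‖ ^ 2 ≤ K) (hX : ∀ i < s, Measurable (X i))
    (hP : ∀ i < s, μ.map (X i) = P) {i : ℕ} (hi : i < s) :
    Integrable (fun ω => h₁ lam Y (X i ω) (iterate lam B Y J 0 (fun l => X l ω) i)) μ := by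
  have hφ : Measurable fun z : (ℕ → E m) × E m =>
      h₁ lam Y z.2 (iterate lam B Y J 0 z.1 i) := by
    have h1 : Measurable fun z : (ℕ → E m) × E m => (z.2, iterate lam B Y J 0 z.1 i) :=
      measurable_snd.prodMk ((measurable_iterate hJ i).comp measurable_fst)
    have h2 := (measurable_minCost Y).comp h1
    have h3 := (measurable_logMeanExp lam).comp (measurable_snd.comp h1)
    have h4 := h2.sub h3
    exact h4
  set R := ∑ k ∈ Finset.range i, learningRate n B (k + 1)
  have := integrable_of_past (μ := μ) hX hi (R := K + R + R) hφ (by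
    filter_upwards [ae_forall_sample hX hP hK] with ω h
    have hR := abs_iterate_le hn hB lam Y J (past X i ω) i
    rw [h₁_eq]
    exact (abs_sub _ _).trans (add_le_add (abs_minCost_le hn (h i hi) hR)
      (abs_logMeanExp_le hn hlam hR)))
  simpa only [iterate_past X (le_refl i)] using this

theorem integrable_estimate (hn : 1 ≤ n) (hlam : 0 < lam) (hB : 0 < B) (hJ : IsArgminRule Y J)
    (hK : ∀ᵐ x ∂P, ∀ j, ‖x - Y j‖ ^ 2 ≤ K) (hX : ∀ i < s, Measurable (X i))
    (hP : ∀ i < s, μ.map (X i) = P) :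
    Integrable (fun ω => estimate lam B Y J 0 s fun i => X i ω) μ := by
  unfold estimate
  exact (integrable_finsetSum _ fun i hi => (integrable_h₁_iterate hn hlam hB hJ hK hX hP
    (Finset.mem_range.mp hi)).const_mul _).div_const _

variable [IsProbabilityMeasure P]

theorem integrable_h₁ (hn : 1 ≤ n) (hK : ∀ᵐ x ∂P, ∀ j, ‖x - Y j‖ ^ 2 ≤ K) (lam : ℝ)
    (g : Fin n → ℝ) : Integrable (fun x => h₁ lam Y x g) P :=
  (integrable_minCost hn hK g).sub (integrable_const _)

theorem integral_h₁ (hn : 1 ≤ n) (hK : ∀ᵐ x ∂P, ∀ j, ‖x - Y j‖ ^ 2 ≤ K) (lam : ℝ)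
    (g : Fin n → ℝ) : ∫ x, h₁ lam Y x g ∂P = ∫ x, minCost Y x g ∂P - logMeanExp lam g := by
  simp only [h₁_eq]
  rw [integral_sub (integrable_minCost hn hK g) (integrable_const _)]
  simp

theorem rsw_ne_top (hn : 1 ≤ n) (hlam : 0 < lam) (hK : ∀ᵐ x ∂P, ∀ j, ‖x - Y j‖ ^ 2 ≤ K) :
    rsw lam (empirical Y) P ≠ ∞ := by
  obtain ⟨-, h, -⟩ := exists_rsw_le (P := P) hn hlam one_pos hK
  exact h

theorem integral_h₁_le_rsw (hn : 1 ≤ n) (hlam : 0 < lam)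
    (hK : ∀ᵐ x ∂P, ∀ j, ‖x - Y j‖ ^ 2 ≤ K) (g : Fin n → ℝ) :
    ∫ x, h₁ lam Y x g ∂P ≤ (rsw lam (empirical Y) P).toReal :=
  (ENNReal.ofReal_le_iff_le_toReal (rsw_ne_top hn hlam hK)).mp
    (ofReal_integral_h₁_le_rsw hn hlam g (integrable_minCost hn hK g))

/-- Strong duality with a bounded potential. -/
theorem exists_bounded_rsw_le (hn : 1 ≤ n) (hlam : 0 < lam) (hK0 : 0 ≤ K)
    (hK : ∀ᵐ x ∂P, ∀ j, ‖x - Y j‖ ^ 2 ≤ K) {ε : ℝ} (hε : 0 < ε) :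
    ∃ u : Fin n → ℝ, (∀ j, 0 ≤ u j ∧ u j ≤ K) ∧
      (rsw lam (empirical Y) P).toReal ≤ ∫ x, h₁ lam Y x u ∂P + ε := by
  have hn' : (0 : ℝ) < n := by exact_mod_cast hn
  -- Temperature `ε / n` turns the smoothing error `n * (ε / n)` into `ε`.
  obtain ⟨g, -, hg⟩ := exists_rsw_le (P := P) hn hlam (div_pos hε hn') hK
  obtain ⟨u, hu, hgu⟩ := exists_bounded_potential hn hlam hK0 Y g
  refine ⟨u, hu, hg.trans ?_⟩
  rw [mul_div_cancel₀ _ hn'.ne']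
  refine add_le_add_left ?_ ε
  refine integral_mono_ae (integrable_h₁ hn hK lam g) (integrable_h₁ hn hK lam u) ?_
  filter_upwards [hK] with x hx
  exact hgu x hx

theorem sum_learningRate_pos (hn : 1 ≤ n) (hB : 0 < B) (hs : 1 ≤ s) :
    0 < ∑ i ∈ Finset.range s, learningRate n B (i + 1) :=
  Finset.sum_pos (fun i _ => learningRate_pos hn hB i) ⟨0, Finset.mem_range.mpr hs⟩

/-- The error is controlled by the deviations and by the regret against any potential `u`. -/
theorem mul_abs_estimate_sub_le (hn : 1 ≤ n) (hs : 1 ≤ s) (hlam : 0 < lam) (hB : 0 < B)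
    (hJ : IsArgminRule Y J) (hK : ∀ᵐ x ∂P, ∀ j, ‖x - Y j‖ ^ 2 ≤ K) {u : Fin n → ℝ}
    (hu : ∀ j, 0 ≤ u j ∧ u j ≤ K) (x : ℕ → E m) :
    (∑ i ∈ Finset.range s, learningRate n B (i + 1)) *
        |estimate lam B Y J 0 s x - (rsw lam (empirical Y) P).toReal|
      ≤ |deviationSum lam B Y J P s x| + deviationSum lam B Y J P s x
        + (n * K ^ 2 / 2 + ∑ i ∈ Finset.range s, learningRate n B (i + 1) ^ 2)
        + ∑ i ∈ Finset.range s, learningRate n B (i + 1) *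
          ((rsw lam (empirical Y) P).toReal - h₁ lam Y (x i) u) := by
  set W := ∑ i ∈ Finset.range s, learningRate n B (i + 1) with hW
  set ℓ := (rsw lam (empirical Y) P).toReal
  set S := deviationSum lam B Y J P s x with hS
  have hW0 : 0 < W := sum_learningRate_pos hn hB hs
  set T := ∑ i ∈ Finset.range s,
    learningRate n B (i + 1) * h₁ lam Y (x i) (iterate lam B Y J 0 x i) with hT
  have h1 : W * |estimate lam B Y J 0 s x - ℓ| = |T - W * ℓ| := by
    rw [← abs_of_pos hW0, ← abs_mul, abs_of_pos hW0, estimate, mul_sub, mul_div_cancel₀ _ hW0.ne']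
  -- Subtracting the deviations replaces each sampled value by its `P`-mean at that iterate, to
  -- which weak duality applies.
  have h2 : T - S ≤ W * ℓ := by
    rw [hT, hS, deviationSum, ← Finset.sum_sub_distrib, hW, Finset.sum_mul]
    refine Finset.sum_le_sum fun i _ => ?_
    rw [← mul_sub]
    refine mul_le_mul_of_nonneg_left ?_ (learningRate_pos hn hB i).le
    have := integral_h₁_le_rsw hn hlam hK (iterate lam B Y J 0 x i)
    rw [integral_h₁ hn hK] at this
    rw [h₁_eq, deviation]
    linarith
  have h3 := regret_le hlam hB hJ hn x u s
  have h4 : ∑ j, u j ^ 2 ≤ n * K ^ 2 := by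
    refine (Finset.sum_le_card_nsmul _ _ (K ^ 2) fun j _ => ?_).trans (by simp)
    exact pow_le_pow_left₀ (hu j).1 (hu j).2 2
  simp only [mul_sub, Finset.sum_sub_distrib, ← Finset.sum_mul, ← hW, ← hT] at h3 ⊢
  rw [h1] at *
  -- The sign of `T - S - W * ℓ` is known, so the triangle inequality leaves only `|S|` inside an
  -- absolute value.
  have h5 : |T - W * ℓ| ≤ |S| + (W * ℓ - T + S) := by
    have := abs_add_le S (T - S - W * ℓ)
    rw [abs_of_nonpos (by linarith : T - S - W * ℓ ≤ 0)] at this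
    have e : S + (T - S - W * ℓ) = T - W * ℓ := by ring
    rw [e] at this
    linarith
  linarith

theorem integral_abs_estimate_sub_le (hn : 1 ≤ n) (hs : 1 ≤ s) (hlam : 0 < lam) (hB : 0 < B)
    (hK0 : 0 ≤ K) (hJ : IsArgminRule Y J) (hK : ∀ᵐ x ∂P, ∀ j, ‖x - Y j‖ ^ 2 ≤ K)
    (hX : ∀ i < s, Measurable (X i)) (hP : ∀ i < s, μ.map (X i) = P)
    (hind : iIndepFun (fun i : Fin s => X i) μ) :
    ∫ ω, |(estimate lam B Y J 0 s fun i => X i ω) - (rsw lam (empirical Y) P).toReal| ∂μ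
      ≤ K * √((1 + Real.log s) / s)
        + √((n : ℝ) / s) * (K ^ 2 / (2 * B) + B * (1 + Real.log s)) := by
  set W := ∑ i ∈ Finset.range s, learningRate n B (i + 1) with hW
  set V := ∑ i ∈ Finset.range s, learningRate n B (i + 1) ^ 2 with hV
  set ℓ := (rsw lam (empirical Y) P).toReal with hℓ
  have hW0 : 0 < W := sum_learningRate_pos hn hB hs
  have hn' : (0 : ℝ) < n := by exact_mod_cast hn
  have hs' : (1 : ℝ) ≤ s := by exact_mod_cast hs
  have hlog : 0 ≤ Real.log s := Real.log_nonneg hs'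
  -- The potential `u` is optimal only up to `ε / W`. Weighted by the rates this costs `ε` in all,
  -- which is then sent to `0`.
  have main : W * ∫ ω, |(estimate lam B Y J 0 s fun i => X i ω) - ℓ| ∂μ
      ≤ K * √V + (n * K ^ 2 / 2 + V) := by
    refine le_of_forall_pos_le_add fun ε hε => ?_
    obtain ⟨u, hu, hℓu⟩ := exists_bounded_rsw_le (P := P) hn hlam hK0 hK (div_pos hε hW0)
    have iS : Integrable (fun ω => deviationSum lam B Y J P s fun l => X l ω) μ :=
      (memLp_deviationSum hn hB hJ hK hX hP le_rfl 1).integrable le_rfl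
    have hm : Measurable fun x => h₁ lam Y x u := (measurable_minCost_left Y u).sub_const _
    have ih : ∀ i ∈ Finset.range s, Integrable (fun ω =>
        learningRate n B (i + 1) * (ℓ - h₁ lam Y (X i ω) u)) μ := by
      intro i hi
      have h : Integrable (fun x => h₁ lam Y x u) (μ.map (X i)) := by
        rw [hP i (Finset.mem_range.mp hi)]
        exact integrable_h₁ hn hK lam u
      exact ((integrable_const _).sub
        (h.comp_measurable (hX i (Finset.mem_range.mp hi)))).const_mul _
    have eh : ∀ i ∈ Finset.range s, ∫ ω, learningRate n B (i + 1) * (ℓ - h₁ lam Y (X i ω) u) ∂μ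
        ≤ learningRate n B (i + 1) * (ε / W) := by
      intro i hi
      have hi' := Finset.mem_range.mp hi
      have h : Integrable (fun x => h₁ lam Y x u) (μ.map (X i)) := by
        rw [hP i hi']
        exact integrable_h₁ hn hK lam u
      have h' : Integrable (fun ω => h₁ lam Y (X i ω) u) μ := h.comp_measurable (hX i hi')
      have e : ∫ ω, h₁ lam Y (X i ω) u ∂μ = ∫ x, h₁ lam Y x u ∂P := by
        rw [← hP i hi', integral_map (hX i hi').aemeasurable hm.aestronglyMeasurable]
      rw [integral_const_mul, integral_sub (integrable_const _) h', e]
      refine mul_le_mul_of_nonneg_left ?_ (learningRate_pos hn hB i).le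
      simp
      linarith
    have iest : Integrable (fun ω => |(estimate lam B Y J 0 s fun i => X i ω) - ℓ|) μ :=
      ((integrable_estimate hn hlam hB hJ hK hX hP).sub (integrable_const _)).abs
    have a1 : Integrable (fun ω => |deviationSum lam B Y J P s fun l => X l ω|
        + deviationSum lam B Y J P s fun l => X l ω) μ := iS.abs.add iS
    have a2 : Integrable (fun ω => |deviationSum lam B Y J P s fun l => X l ω|
        + (deviationSum lam B Y J P s fun l => X l ω) + (n * K ^ 2 / 2 + V)) μ :=
      a1.add (integrable_const _)
    have a3 : Integrable (fun ω => ∑ i ∈ Finset.range s,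
        learningRate n B (i + 1) * (ℓ - h₁ lam Y (X i ω) u)) μ := integrable_finsetSum _ ih
    have h1 := integral_mono (iest.const_mul W) (a2.add a3) fun ω =>
      mul_abs_estimate_sub_le hn hs hlam hB hJ hK hu fun l => X l ω
    simp only [Pi.add_apply] at h1
    rw [integral_const_mul, integral_add a2 a3, integral_add a1 (integrable_const _),
      integral_add iS.abs iS, integral_finsetSum _ ih,
      integral_deviationSum hn hJ hK hX hP hind] at h1
    have h2 := integral_abs_deviationSum_le (lam := lam) hn hB hK0 hJ hK hX hP hind
    have h3 := Finset.sum_le_sum eh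
    rw [← Finset.sum_mul, ← hW, mul_div_cancel₀ _ hW0.ne'] at h3
    simp only [integral_const, probReal_univ, one_smul] at h1
    linarith
  have hWle : B * √(n * s) ≤ W := le_sum_learningRate hB hs
  have hVle : V ≤ B ^ 2 * n * (1 + Real.log s) := sum_learningRate_sq_le n B s
  have hs0 : (0 : ℝ) < s := by linarith
  have e1 : √V ≤ W * √((1 + Real.log s) / s) := by
    calc √V ≤ √((B * √(n * s)) ^ 2 * ((1 + Real.log s) / s)) := by
          refine Real.sqrt_le_sqrt (hVle.trans (le_of_eq ?_))
          rw [mul_pow, Real.sq_sqrt (by positivity)]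
          field_simp
      _ = B * √(n * s) * √((1 + Real.log s) / s) := by
          rw [Real.sqrt_mul (sq_nonneg _), Real.sqrt_sq (by positivity)]
      _ ≤ _ := by gcongr
  -- The factor `B * √(n * s)` is split off through `√(n * s) * √(n / s) = n` and then replaced by
  -- the larger `W`.
  have e2 : n * K ^ 2 / 2 + V ≤ W * (√((n : ℝ) / s) *
      (K ^ 2 / (2 * B) + B * (1 + Real.log s))) := by
    calc n * K ^ 2 / 2 + V ≤ n * K ^ 2 / 2 + B ^ 2 * n * (1 + Real.log s) := by gcongr
      _ = B * √(n * s) * (√((n : ℝ) / s) * (K ^ 2 / (2 * B) + B * (1 + Real.log s))) := by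
          have : √((n : ℝ) * s) * √((n : ℝ) / s) = n := by
            rw [← Real.sqrt_mul (by positivity)]
            rw [show (n : ℝ) * s * (n / s) = n ^ 2 by field_simp, Real.sqrt_sq hn'.le]
          rw [← mul_assoc, mul_assoc B, this]
          field_simp
      _ ≤ _ := by gcongr
  refine le_of_mul_le_mul_left ?_ hW0
  calc _ ≤ K * √V + (n * K ^ 2 / 2 + V) := main
    _ ≤ K * (W * √((1 + Real.log s) / s)) + W * (√((n : ℝ) / s) *
      (K ^ 2 / (2 * B) + B * (1 + Real.log s))) := by gcongr
    _ = _ := by ring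

end Accuracy

end RSW

theorem mainTheorem2 :
    -- accuracy
    (∀ (m n s : ℕ), 1 ≤ n → 1 ≤ s →
      ∀ (A : Set (RSW.E m)) (D lam : ℝ), (∀ x ∈ A, ∀ y ∈ A, ‖x - y‖ ≤ D) → 0 ∈ A → 0 < lam →
      ∀ (Y : Fin n → RSW.E m), (∀ j, Y j ∈ A) →
      ∀ (P : Measure (RSW.E m)) [IsProbabilityMeasure P], (∀ᵐ x ∂P, x ∈ A) →
      ∀ (Ω : Type*) [MeasurableSpace Ω] (μ : Measure Ω) [IsProbabilityMeasure μ]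
        (X : ℕ → Ω → RSW.E m),
        (∀ i < s, Measurable (X i)) → (∀ i < s, μ.map (X i) = P) →
        iIndepFun (fun i : Fin s => X i) μ →
      ∀ (J : RSW.E m → (Fin n → ℝ) → Fin n), RSW.IsArgminRule Y J →
      ∀ B : ℝ, 0 < B →
        RSW.rsw lam (RSW.empirical Y) P ≠ ∞ ∧
        Integrable (fun ω => RSW.estimate lam B Y J 0 s (fun i => X i ω)) μ ∧
        (B = D ^ 2 →
          ∫ ω, |RSW.estimate lam B Y J 0 s (fun i => X i ω)
                - (RSW.rsw lam (RSW.empirical Y) P).toReal| ∂μ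
            ≤ 3 * D ^ 2 * √((1 + Real.log s) / s)
              + √((n : ℝ) / s) * (D ^ 2 / 2 + 2 * D ^ 2 * (1 + Real.log s))) ∧
        (B = 1 →
          ∫ ω, |RSW.estimate lam B Y J 0 s (fun i => X i ω)
                - (RSW.rsw lam (RSW.empirical Y) P).toReal| ∂μ
            ≤ 3 * D ^ 2 * √((1 + Real.log s) / s)
              + √((n : ℝ) / s) * (D ^ 4 / 2 + 2 * (1 + Real.log s)))) ∧
    -- running time
    (∃ C : ℕ, ∀ (m n : ℕ), 1 ≤ n → ∀ (Y : Fin n → RSW.E m),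
      ∃ J : RSW.E m → (Fin n → ℝ) → Fin n, RSW.IsArgminRule Y J ∧
        ∀ (s : ℕ), 1 ≤ s → ∀ (lam B : ℝ), 0 < lam → 0 < B →
        ∀ (g₀ : Fin n → ℝ) (X : ℕ → RSW.E m) (σ : RealRAM.State RSW.IVar RSW.RVar RSW.Arr),
          RSW.HoldsInput lam B Y g₀ s X σ →
            (RSW.program.run σ).1.reg .out = RSW.estimate lam B Y J g₀ s X ∧
            (∀ j : Fin n, (RSW.program.run σ).1.arr .g j = RSW.iterate lam B Y J g₀ X s j) ∧
            (RSW.program.run σ).2 ≤ C * (m + 1) * n * s) := by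

  refine ⟨?_, 300, fun m n hn Y => ⟨RSW.firstArgmin hn Y, RSW.isArgminRule_firstArgmin hn Y, ?_⟩⟩
  · intro m n s hn hs A D lam hD h0 hlam Y hY P _ hPA Ω _ μ _ X hX hP hind J hJ B hB
    have hD0 : 0 ≤ D := by simpa using hD 0 h0 0 h0
    have hK : ∀ᵐ x ∂P, ∀ j, ‖x - Y j‖ ^ 2 ≤ D ^ 2 := by
      filter_upwards [hPA] with x hx j
      exact pow_le_pow_left₀ (norm_nonneg _) (hD x hx _ (hY j)) 2
    -- With `K = D ^ 2`, the quantity `K ^ 2 / (2 * B)` is `D ^ 2 / 2` for `B = D ^ 2` and `D ^ 4 /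
    -- 2` for `B = 1`. The claimed factors `3` and `2` are weaker than what `key` provides.
    have key := RSW.integral_abs_estimate_sub_le hn hs hlam hB (sq_nonneg D) hJ hK hX hP hind
    have hlog : 0 ≤ Real.log s := Real.log_nonneg (by exact_mod_cast hs)
    have h3 : D ^ 2 * √((1 + Real.log s) / s) ≤ 3 * D ^ 2 * √((1 + Real.log s) / s) := by
      gcongr
      nlinarith [sq_nonneg D]
    refine ⟨RSW.rsw_ne_top hn hlam hK, RSW.integrable_estimate hn hlam hB hJ hK hX hP, ?_, ?_⟩
    · intro hBD
      refine key.trans (add_le_add h3 (mul_le_mul_of_nonneg_left ?_ (Real.sqrt_nonneg _)))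
      rw [← hBD]
      have : B ^ 2 / (2 * B) = B / 2 := by field_simp
      rw [this]
      nlinarith
    · intro hB1
      refine key.trans (add_le_add h3 (mul_le_mul_of_nonneg_left ?_ (Real.sqrt_nonneg _)))
      rw [hB1]
      nlinarith
  · intro s hs lam B _ _ g₀ X σ h
    obtain ⟨⟨h1, h2⟩, h3⟩ := RSW.program_spec hn hs h
    exact ⟨h1, h2, h3⟩
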